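/- Let $\Lambda\subset\mathbb R^3$ be a lattice, i.e. the set of all integer linear combinations of a basis of $\mathbb R^3$. An \emph{obtuse superbase} of $\Lambda$ is a quadruple $B=(v_0,v_1,v_2,v_3)$ such that $v_1,v_2,v_3$ is a basis of $\mathbb R^3$ generating $\Lambda$, $v_0=-v_1-v_2-v_3$, and $-v_i\cdot v_j\ge 0$ for all $i\ne j$. Its \emph{root products} are $r_{ij}=r_{ji}=\sqrt{-v_i\cdot v_j}$ ($i\neq j$), and its \emph{root form} is the matrix $\begin{pmatrix} r_{23}&r_{13}&r_{12}\\ r_{01}&r_{02}&r_{03}\end{pmatrix}$. Reordering $v_0,v_1,v_2,v_3$ gives 24 root forms. The \emph{Voronoi domain} of $\Lambda$ is $V(\Lambda)=\{p\in\mathbb R^3: |p|\le|p-v| \text{ for all } v\in\Lambda\}$. The lattice has \emph{Voronoi type} $V_1,V_2,V_3,V_4,V_5$ if $V(\Lambda)$ is combinatorially (i.e. its face lattice is isomorphic to that of) a truncated octahedron, a hexa-rhombic (elongated) dodecahedron, a rhombic dodecahedron, a hexagonal prism, or a cuboid, respectively. The \emph{root invariant} $\mathrm{RI}(B)$ consists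 of the Voronoi type of $\Lambda$ together with the following data, where in each case $v_0,\dots,v_3$ are first reordered so that the zero root products are as indicated and all other root products are positive. - $V_1$ (no zero root product): the lexicographically smallest of the 24 root forms, entries being read in the order $r_{23},r_{13},r_{12},r_{01},r_{02},r_{03}$. In particular $r_{23}$ is the minimum of all entries, $r_{13}$ is the minimum of $r_{13},r_{12},r_{02},r_{03}$, $r_{23}\le r_{13}\le r_{12}$, if $r_{23}=r_{13}$ then $r_{01}\le r_{02}$, and if $r_{13}=r_{12}$ then $r_{02}\le r_{03}$. - $V_2$ (only $r_{23}=0$): $\{r_{01},(r_{13},r_{12},r_{02}),r_{03}\}$, where the $2\times2$ submatrix $\begin{pmatrix} r_{13}&r_{12}\\ r_{02}&r_{03}\end{pmatrix}$ is rearranged by the symmetry group $D_4$ of a square so that $r_{13}\le r_{03}$, $r_{13}\le r_{12}\le r_{02}$, and $r_{02}\le r_{03}$ if $r_{13}=r_{12}$. - $V_3$ (only $r_{23}=r_{01}=0$): the four non-zero root products in increasing order. - $V_4$ (only $r_{23}=r_{13}=0$): $\{(a,b,c),r_{03}\}$, where $a\le b\le c$ are $r_{12},r_{01},r_{02}$ in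 increasing order. - $V_5$ (exactly three zero root products): the three non-zero root products in increasing order. Here increasing means non-strictly increasing, and root invariants of different types are considered different. \textbf{Theorem.} Every lattice $\Lambda\subset\mathbb R^3$ has an obtuse superbase. Every obtuse superbase $B$ of $\Lambda$ has exactly one root invariant $\mathrm{RI}(B)$, and it does not depend on $B$, so it can be denoted by $\mathrm{RI}(\Lambda)$. Two lattices $\Lambda,\Lambda'\subset\mathbb R^3$ are isometric (there is a distance-preserving map $f:\mathbb R^3\to\mathbb R^3$ with $f(\Lambda)=\Lambda'$) if and only if $\mathrm{RI}(\Lambda)=\mathrm{RI}(\Lambda')$. -/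

import Mathlib

/-- Euclidean space `ℝ³`. -/
abbrev E3 : Type := EuclideanSpace ℝ (Fin 3)

/-! ## Voronoi domains and the five Voronoi types -/

/-- The Voronoi domain `V(Λ)`: all points that are at least as close to `0` as to any other
lattice point. -/
def voronoiDomain (Λ : Submodule ℤ E3) : Set E3 :=
  {p | ∀ v ∈ Λ, ‖p‖ ≤ ‖p - v‖}

/-- Two polytopes are combinatorially equivalent if their face lattices are isomorphic.
The faces of a polytope (with the empty face and the polytope itself) are its exposed subsets. -/
def CombEquiv (P Q : Set E3) : Prop :=
  Nonempty ({F : Set E3 // IsExposed ℝ P F} ≃o {F : Set E3 // IsExposed ℝ Q F})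

/-- Truncated octahedron: 6 squares and 8 hexagons. -/
def truncatedOctahedron : Set E3 :=
  {p | |p 0| ≤ 2 ∧ |p 1| ≤ 2 ∧ |p 2| ≤ 2 ∧ |p 0| + |p 1| + |p 2| ≤ 3}

/-- Hexa-rhombic (elongated) dodecahedron: a rhombic dodecahedron stretched along an axis through
two opposite 4-valent vertices; 4 hexagons and 8 rhombi. -/
def hexaRhombicDodecahedron : Set E3 :=
  {p | |p 0| + |p 1| ≤ 1 ∧ |p 0| + |p 2| ≤ 2 ∧ |p 1| + |p 2| ≤ 2}

/-- Rhombic dodecahedron: 12 rhombi. -/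
def rhombicDodecahedron : Set E3 :=
  {p | |p 0| + |p 1| ≤ 1 ∧ |p 0| + |p 2| ≤ 1 ∧ |p 1| + |p 2| ≤ 1}

/-- Hexagonal prism, over the hexagon `|x|, |y|, |x + y| ≤ 1`. -/
def hexagonalPrism : Set E3 :=
  {p | |p 0| ≤ 1 ∧ |p 1| ≤ 1 ∧ |p 0 + p 1| ≤ 1 ∧ |p 2| ≤ 1}

/-- Cuboid (here a cube; only the combinatorial type matters). -/
def cuboid : Set E3 :=
  {p | |p 0| ≤ 1 ∧ |p 1| ≤ 1 ∧ |p 2| ≤ 1}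

/-! ## Obtuse superbases and root products -/

/-- `B = (v₀, v₁, v₂, v₃)` is an obtuse superbase of `Λ`: `v₁, v₂, v₃` is a basis of `ℝ³` that
generates `Λ`, `v₀ = -v₁ - v₂ - v₃`, and all conorms `p_ij = -v_i · v_j` (`i ≠ j`) are
non-negative. -/
structure IsObtuseSuperbase (Λ : Submodule ℤ E3) (B : Fin 4 → E3) : Prop where
  linearIndependent : LinearIndependent ℝ ![B 1, B 2, B 3]
  span_eq : Submodule.span ℤ (Set.range ![B 1, B 2, B 3]) = Λ
  zero_eq : B 0 = -B 1 - B 2 - B 3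
  obtuse : ∀ i j, i ≠ j → 0 ≤ -(inner ℝ (B i) (B j))

/-- The root product `r_ij = √(-v_i · v_j)`. -/
noncomputable def rootProduct (B : Fin 4 → E3) (i j : Fin 4) : ℝ :=
  Real.sqrt (-(inner ℝ (B i) (B j)))

/-- The root form of an ordered superbase: the `2 × 3` matrix of its six root products. -/
noncomputable def rootForm (B : Fin 4 → E3) : Matrix (Fin 2) (Fin 3) ℝ :=
  !![rootProduct B 2 3, rootProduct B 1 3, rootProduct B 1 2;
     rootProduct B 0 1, rootProduct B 0 2, rootProduct B 0 3]

/-- The entries of a `2 × 3` matrix, top row first, as a vector in the lexicographic order. -/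
def rowLex (M : Matrix (Fin 2) (Fin 3) ℝ) : Lex (Fin 6 → ℝ) :=
  toLex ![M 0 0, M 0 1, M 0 2, M 1 0, M 1 1, M 1 2]

/-! ## Root invariants -/

/-- Values of root invariants, one shape for each of the five Voronoi types. -/
inductive RootInvariant : Type
  /-- a `2 × 3` matrix -/
  | V1 (M : Matrix (Fin 2) (Fin 3) ℝ)
  /-- `1 + 3 + 1` numbers `{r₀₁, (r₁₃, r₁₂, r₀₂), r₀₃}` -/
  | V2 (r01 r13 r12 r02 r03 : ℝ)
  /-- an ordered quadruple -/
  | V3 (a b c d : ℝ)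
  /-- `3 + 1` numbers `{(a, b, c), r₀₃}` -/
  | V4 (a b c r03 : ℝ)
  /-- an ordered triple -/
  | V5 (a b c : ℝ)

/-- `ρ` is the root invariant `RI(B)` of the obtuse superbase `B` of the lattice `Λ`.
The 24 index-permutations are the reorderings `B ∘ σ` of the superbase. -/
def IsRootInvariant (Λ : Submodule ℤ E3) (B : Fin 4 → E3) : RootInvariant → Prop
  /- No zero root product. The matrix is the lexicographically first of the 24 root forms, so
  `r₂₃` is the least of all entries, `r₁₃` is the least entry of columns 2 and 3,
  `r₂₃ ≤ r₁₃ ≤ r₁₂`, if `r₂₃ = r₁₃` then `r₀₁ ≤ r₀₂`, and if `r₁₃ = r₁₂` then `r₀₂ ≤ r₀₃`. -/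
  | .V1 M =>
      CombEquiv (voronoiDomain Λ) truncatedOctahedron ∧
      (∀ i j, i ≠ j → rootProduct B i j ≠ 0) ∧
      (∃ σ : Equiv.Perm (Fin 4), M = rootForm (B ∘ σ)) ∧
      ∀ σ : Equiv.Perm (Fin 4), rowLex M ≤ rowLex (rootForm (B ∘ σ))
  /- Only `r₂₃` is zero. The entries of columns 2 and 3 may be moved by the symmetry group of the
  square, that is, by the permutations of its corners that keep the unordered pair of its
  (unordered) diagonals `{r₁₃, r₀₃}` and `{r₁₂, r₀₂}`. -/
  | .V2 r01 r13 r12 r02 r03 =>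
      CombEquiv (voronoiDomain Λ) hexaRhombicDodecahedron ∧
      (∃ σ : Equiv.Perm (Fin 4),
        rootProduct (B ∘ σ) 2 3 = 0 ∧
        rootProduct (B ∘ σ) 0 1 = r01 ∧
        s(s(rootProduct (B ∘ σ) 1 3, rootProduct (B ∘ σ) 0 3),
          s(rootProduct (B ∘ σ) 1 2, rootProduct (B ∘ σ) 0 2)) = s(s(r13, r03), s(r12, r02))) ∧
      0 < r01 ∧ 0 < r13 ∧ r13 ≤ r03 ∧ r13 ≤ r12 ∧ r12 ≤ r02 ∧ (r13 = r12 → r02 ≤ r03)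
  /- Only `r₂₃` and `r₀₁` (one column) are zero. -/
  | .V3 a b c d =>
      CombEquiv (voronoiDomain Λ) rhombicDodecahedron ∧
      (∃ σ : Equiv.Perm (Fin 4),
        rootProduct (B ∘ σ) 2 3 = 0 ∧ rootProduct (B ∘ σ) 0 1 = 0 ∧
        ({rootProduct (B ∘ σ) 1 3, rootProduct (B ∘ σ) 1 2, rootProduct (B ∘ σ) 0 2,
          rootProduct (B ∘ σ) 0 3} : Multiset ℝ) = {a, b, c, d}) ∧
      0 < a ∧ a ≤ b ∧ b ≤ c ∧ c ≤ d
  /- Only `r₂₃` and `r₁₃` (different columns) are zero. -/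
  | .V4 a b c r03 =>
      CombEquiv (voronoiDomain Λ) hexagonalPrism ∧
      (∃ σ : Equiv.Perm (Fin 4),
        rootProduct (B ∘ σ) 2 3 = 0 ∧ rootProduct (B ∘ σ) 1 3 = 0 ∧
        ({rootProduct (B ∘ σ) 1 2, rootProduct (B ∘ σ) 0 1,
          rootProduct (B ∘ σ) 0 2} : Multiset ℝ) = {a, b, c} ∧
        rootProduct (B ∘ σ) 0 3 = r03) ∧
      0 < r03 ∧ 0 < a ∧ a ≤ b ∧ b ≤ c
  /- Exactly three root products are non-zero. -/
  | .V5 a b c =>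
      CombEquiv (voronoiDomain Λ) cuboid ∧
      ({rootProduct B 2 3, rootProduct B 1 3, rootProduct B 1 2,
        rootProduct B 0 1, rootProduct B 0 2, rootProduct B 0 3} : Multiset ℝ) =
          {0, 0, 0, a, b, c} ∧
      0 < a ∧ a ≤ b ∧ b ≤ c

instance : Inhabited RootInvariant := ⟨.V5 0 0 0⟩

/-- The root invariant `RI(Λ)`: the root invariant of an obtuse superbase of `Λ`. -/
noncomputable def RI (Λ : Submodule ℤ E3) : RootInvariant :=
  Classical.epsilon fun ρ => ∃ B, IsObtuseSuperbase Λ B ∧ IsRootInvariant Λ B ρ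

/-! Existence is Selling's reduction. Among superbases of bounded total squared length there are
finitely many, and replacing one with an acute pair by its Selling transform strictly shortens it,
so a shortest one is obtuse (`exists_isObtuseSuperbase`).

Independence of the superbase is the duality of conorms and vonorms. By Selling's formula the least
squared norm in a class of `Λ / 2Λ` is a sum of conorms over the index pairs that the class
separates. These minima depend on `Λ` alone, and an orthogonality relation for characters recovers
the conorms from them. Hence the six conorms, with an extra value zero at a seventh point, form a
function on the Fano plane of nonzero characters of `Λ / 2Λ` which is intrinsic up to collineation
(`IsObtuseSuperbase.exists_collineation`). A collineation between two such functions matches their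
zeros, and the stabiliser of each of the possible zero sets permutes the remaining values only in
ways that the ordering conventions of the root invariant absorb (`IsRootData.unique`).

Completeness needs the converse: each such rearrangement comes from an actual superbase. Reorderings
alone do not suffice; the missing ones are Selling transformations at an orthogonal pair
(`HasRootProducts.twist`). So every lattice has an obtuse superbase whose root products stand
exactly as in its invariant (`IsRootData.hasNormalForm`). Equal invariants then give equal Gram
matrices, hence an isometry.

The Voronoi type is redundant information. The Voronoi domain is a zonotope whose generators are the
differences of `0` and the dual basis, scaled by half the conorms (`voronoiDomain_eq_zonotope`), so
its face lattice depends only on which conorms vanish. Each model polytope is a zonotope of the same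
shape with the matching zeros. -/

/-! ### Conorms and Selling's formula -/

/-- The conorm `p_ij = -v_i · v_j`. -/
noncomputable def conorm (B : Fin 4 → E3) (i j : Fin 4) : ℝ := -inner ℝ (B i) (B j)

theorem conorm_comm (B : Fin 4 → E3) (i j : Fin 4) : conorm B i j = conorm B j i := by
  simp only [conorm, real_inner_comm]

theorem rootProduct_comm (B : Fin 4 → E3) (i j : Fin 4) :
    rootProduct B i j = rootProduct B j i := by
  simp only [rootProduct, real_inner_comm]

theorem rootProduct_comp (B : Fin 4 → E3) (σ : Fin 4 → Fin 4) (i j : Fin 4) :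
    rootProduct (B ∘ σ) i j = rootProduct B (σ i) (σ j) := rfl

theorem rootProduct_nonneg (B : Fin 4 → E3) (i j : Fin 4) : 0 ≤ rootProduct B i j :=
  Real.sqrt_nonneg _

/-- A description of obtuse superbases which is symmetric in the four vectors. -/
theorem isObtuseSuperbase_iff {Λ : Submodule ℤ E3} [DiscreteTopology Λ] [IsZLattice ℝ Λ]
    {B : Fin 4 → E3} : IsObtuseSuperbase Λ B ↔
      ∑ i, B i = 0 ∧ Submodule.span ℤ (Set.range B) = Λ ∧ ∀ i j, i ≠ j → 0 ≤ conorm B i j := by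
  have hsub : Submodule.span ℤ (Set.range ![B 1, B 2, B 3]) ≤ Submodule.span ℤ (Set.range B) := by
    apply Submodule.span_mono
    rintro _ ⟨i, rfl⟩
    fin_cases i <;> simp
  have key : ∑ i, B i = 0 →
      Submodule.span ℤ (Set.range ![B 1, B 2, B 3]) = Submodule.span ℤ (Set.range B) := by
    intro h
    refine le_antisymm hsub ?_
    rw [Submodule.span_le]
    have h1 : B 1 ∈ Submodule.span ℤ (Set.range ![B 1, B 2, B 3]) :=
      Submodule.subset_span ⟨0, rfl⟩
    have h2 : B 2 ∈ Submodule.span ℤ (Set.range ![B 1, B 2, B 3]) :=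
      Submodule.subset_span ⟨1, rfl⟩
    have h3 : B 3 ∈ Submodule.span ℤ (Set.range ![B 1, B 2, B 3]) :=
      Submodule.subset_span ⟨2, rfl⟩
    have h0 : B 0 = -(B 1 + B 2 + B 3) := by
      rw [Fin.sum_univ_four] at h
      rw [eq_neg_iff_add_eq_zero, ← h]; abel
    rintro _ ⟨i, rfl⟩
    fin_cases i
    · change B 0 ∈ _
      rw [h0]
      exact neg_mem (add_mem (add_mem h1 h2) h3)
    · exact h1
    · exact h2
    · exact h3
  constructor
  · rintro ⟨_, hs, h0, ho⟩
    have hsum : ∑ i, B i = 0 := by rw [Fin.sum_univ_four, h0]; abel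
    exact ⟨hsum, by rw [← key hsum, hs], ho⟩
  · rintro ⟨hsum, hs, ho⟩
    have hs' := (key hsum).trans hs
    refine ⟨?_, hs', ?_, ho⟩
    -- Three vectors that span `ℝ³` are independent, and they span because `Λ` does.
    · apply linearIndependent_of_top_le_span_of_card_eq_finrank
      · rw [← IsZLattice.span_top (K := ℝ) (L := Λ), Submodule.span_le, ← hs']
        exact Submodule.span_subset_span ℤ ℝ _
      · simp
    · rw [Fin.sum_univ_four] at hsum
      rw [← sub_eq_zero, ← hsum]; abel

theorem IsObtuseSuperbase.sum_eq_zero {Λ : Submodule ℤ E3} {B : Fin 4 → E3}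
    (h : IsObtuseSuperbase Λ B) : ∑ i, B i = 0 := by
  rw [Fin.sum_univ_four, h.zero_eq]; abel

theorem IsObtuseSuperbase.conorm_nonneg {Λ : Submodule ℤ E3} {B : Fin 4 → E3}
    (h : IsObtuseSuperbase Λ B) {i j : Fin 4} (hij : i ≠ j) : 0 ≤ conorm B i j :=
  h.obtuse i j hij

theorem IsObtuseSuperbase.rootProduct_sq {Λ : Submodule ℤ E3} {B : Fin 4 → E3}
    (h : IsObtuseSuperbase Λ B) {i j : Fin 4} (hij : i ≠ j) :
    rootProduct B i j ^ 2 = conorm B i j :=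
  Real.sq_sqrt (h.obtuse i j hij)

theorem IsObtuseSuperbase.comp_perm {Λ : Submodule ℤ E3} [DiscreteTopology Λ] [IsZLattice ℝ Λ]
    {B : Fin 4 → E3} (h : IsObtuseSuperbase Λ B) (σ : Equiv.Perm (Fin 4)) :
    IsObtuseSuperbase Λ (B ∘ σ) := by
  rw [isObtuseSuperbase_iff] at h ⊢
  obtain ⟨h1, h2, h3⟩ := h
  refine ⟨?_, ?_, fun i j hij => h3 _ _ (σ.injective.ne hij)⟩
  · rw [← h1]; exact Equiv.sum_comp σ B
  · rw [Set.range_comp, σ.surjective.range_eq, Set.image_univ, h2]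

/-- Selling's formula. -/
theorem inner_sum_smul {B : Fin 4 → E3} (hB : ∑ i, B i = 0) (s t : Fin 4 → ℝ) :
    inner ℝ (∑ i, s i • B i) (∑ i, t i • B i) =
      conorm B 0 1 * ((s 0 - s 1) * (t 0 - t 1)) + conorm B 0 2 * ((s 0 - s 2) * (t 0 - t 2)) +
      conorm B 0 3 * ((s 0 - s 3) * (t 0 - t 3)) + conorm B 1 2 * ((s 1 - s 2) * (t 1 - t 2)) +
      conorm B 1 3 * ((s 1 - s 3) * (t 1 - t 3)) + conorm B 2 3 * ((s 2 - s 3) * (t 2 - t 3)) := by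
  -- The rows of the Gram matrix sum to zero, which eliminates the squared norms in favour of
  -- conorms.
  have h (i : Fin 4) : inner ℝ (B i) (B 0) + inner ℝ (B i) (B 1) + inner ℝ (B i) (B 2) +
      inner ℝ (B i) (B 3) = 0 := by
    rw [← inner_add_right, ← inner_add_right, ← inner_add_right, ← Fin.sum_univ_four, hB,
      inner_zero_right]
  have h0 := h 0
  have h1 := h 1
  have h2 := h 2
  have h3 := h 3
  rw [real_inner_comm (B 0) (B 1)] at h1
  rw [real_inner_comm (B 0) (B 2), real_inner_comm (B 1) (B 2)] at h2
  rw [real_inner_comm (B 0) (B 3), real_inner_comm (B 1) (B 3), real_inner_comm (B 2) (B 3)] at h3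
  simp only [Fin.sum_univ_four, inner_add_left, inner_add_right, real_inner_smul_left,
    real_inner_smul_right, conorm]
  rw [real_inner_comm (B 0) (B 1), real_inner_comm (B 0) (B 2), real_inner_comm (B 1) (B 2),
    real_inner_comm (B 0) (B 3), real_inner_comm (B 1) (B 3), real_inner_comm (B 2) (B 3)]
  linear_combination s 0 * t 0 * h0 + s 1 * t 1 * h1 + s 2 * t 2 * h2 + s 3 * t 3 * h3

theorem norm_sq_sum_smul {B : Fin 4 → E3} (hB : ∑ i, B i = 0) (t : Fin 4 → ℝ) :
    ‖∑ i, t i • B i‖ ^ 2 =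
      conorm B 0 1 * (t 0 - t 1) ^ 2 + conorm B 0 2 * (t 0 - t 2) ^ 2 +
      conorm B 0 3 * (t 0 - t 3) ^ 2 + conorm B 1 2 * (t 1 - t 2) ^ 2 +
      conorm B 1 3 * (t 1 - t 3) ^ 2 + conorm B 2 3 * (t 2 - t 3) ^ 2 := by
  rw [← real_inner_self_eq_norm_sq, inner_sum_smul hB]
  ring

/-! ## Selling's transformation -/

/-- Selling's transformation of a superbase. -/
def sellingStep (B : Fin 4 → E3) : Fin 4 → E3 := ![B 0 + B 2, B 1 + B 2, -B 2, B 3]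

theorem sum_sellingStep {B : Fin 4 → E3} (hB : ∑ i, B i = 0) : ∑ i, sellingStep B i = 0 := by
  rw [← hB]
  simp only [sellingStep, Fin.sum_univ_four, Matrix.cons_val]
  abel

theorem span_sellingStep (B : Fin 4 → E3) :
    Submodule.span ℤ (Set.range (sellingStep B)) = Submodule.span ℤ (Set.range B) := by
  apply le_antisymm
  · rw [Submodule.span_le]
    have h (i : Fin 4) : B i ∈ Submodule.span ℤ (Set.range B) := Submodule.subset_span ⟨i, rfl⟩
    rintro _ ⟨i, rfl⟩
    fin_cases i
    · exact add_mem (h 0) (h 2)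
    · exact add_mem (h 1) (h 2)
    · exact neg_mem (h 2)
    · exact h 3
  · rw [Submodule.span_le]
    have h (i : Fin 4) : sellingStep B i ∈ Submodule.span ℤ (Set.range (sellingStep B)) :=
      Submodule.subset_span ⟨i, rfl⟩
    rintro _ ⟨i, rfl⟩
    fin_cases i
    · simpa [sellingStep] using add_mem (h 0) (h 2)
    · simpa [sellingStep] using add_mem (h 1) (h 2)
    · simpa [sellingStep] using neg_mem (h 2)
    · exact h 3

/-- The descent step: the total decreases strictly exactly when vectors 2 and 3 form an acute angle.
-/
theorem sum_norm_sq_sellingStep {B : Fin 4 → E3} (hB : ∑ i, B i = 0) :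
    ∑ i, ‖sellingStep B i‖ ^ 2 = ∑ i, ‖B i‖ ^ 2 + 2 * conorm B 2 3 := by
  have h : inner ℝ (B 2) (B 0 + B 1 + B 2 + B 3) = 0 := by
    rw [← Fin.sum_univ_four, hB, inner_zero_right]
  simp only [inner_add_right] at h
  simp only [sellingStep, Fin.sum_univ_four, Matrix.cons_val, norm_neg, conorm, norm_add_sq_real]
  rw [real_inner_self_eq_norm_sq, real_inner_comm (B 0), real_inner_comm (B 1)] at h
  linear_combination 2 * h

/-- At an orthogonal pair the transformation merely interchanges two conorms, which is why lattices
with a vanishing conorm can have essentially different obtuse superbases. -/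
theorem conorm_sellingStep {B : Fin 4 → E3} (hB : ∑ i, B i = 0) (h23 : conorm B 2 3 = 0) :
    conorm (sellingStep B) 2 3 = 0 ∧ conorm (sellingStep B) 1 3 = conorm B 1 3 ∧
    conorm (sellingStep B) 1 2 = conorm B 0 2 ∧ conorm (sellingStep B) 0 1 = conorm B 0 1 ∧
    conorm (sellingStep B) 0 2 = conorm B 1 2 ∧ conorm (sellingStep B) 0 3 = conorm B 0 3 := by
  have h : inner ℝ (B 2) (B 0 + B 1 + B 2 + B 3) = 0 := by
    rw [← Fin.sum_univ_four, hB, inner_zero_right]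
  simp only [inner_add_right] at h
  rw [real_inner_comm (B 0), real_inner_comm (B 1)] at h
  simp only [conorm] at h23
  simp only [conorm, sellingStep, Matrix.cons_val, inner_add_left, inner_add_right,
    inner_neg_right, inner_neg_left]
  rw [real_inner_comm (B 1) (B 2)]
  refine ⟨?_, ?_, ?_, ?_, ?_, ?_⟩ <;> linarith

/-- A superbase with the least sum of squared norms has no acute pair, since Selling's
transformation would improve it. -/
theorem exists_isObtuseSuperbase (Λ : Submodule ℤ E3) [DiscreteTopology Λ] [IsZLattice ℝ Λ] :
    ∃ B, IsObtuseSuperbase Λ B := by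
  let S : Set (Fin 4 → E3) := {B | ∑ i, B i = 0 ∧ Submodule.span ℤ (Set.range B) = Λ}
  have hmem {B : Fin 4 → E3} (hB : B ∈ S) (i : Fin 4) : B i ∈ Λ := by
    rw [← hB.2]; exact Submodule.subset_span ⟨i, rfl⟩
  obtain ⟨B₀, hB₀⟩ : S.Nonempty := by
    have : Module.Free ℤ Λ := ZLattice.module_free ℝ Λ
    have : Module.Finite ℤ Λ := ZLattice.module_finite ℝ Λ
    have hr : Module.finrank ℤ Λ = 3 := by rw [ZLattice.rank ℝ Λ]; simp
    let b := Module.finBasisOfFinrankEq ℤ Λ hr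
    let B : Fin 4 → E3 := Fin.cons (-∑ i, (b i : E3)) (fun i => (b i : E3))
    refine ⟨B, by simp [B, Fin.sum_univ_succ], ?_⟩
    have hs : Submodule.span ℤ (Set.range fun i => (b i : E3)) = Λ := by
      have := congrArg (Submodule.map Λ.subtype) b.span_eq
      rw [Submodule.map_span, ← Set.range_comp, Submodule.map_top, Submodule.range_subtype] at this
      exact this
    simp only [B, Fin.range_cons]
    rw [Submodule.span_insert_eq_span, hs]
    exact neg_mem (sum_mem fun i _ => Submodule.subset_span ⟨i, rfl⟩)
  let C : ℝ := ∑ i, ‖B₀ i‖ ^ 2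
  -- The bound `C` confines all four vectors to a ball, which contains only finitely many lattice
  -- points; so the minimum is attained.
  let T : Set (Fin 4 → E3) := {B | B ∈ S ∧ ∑ i, ‖B i‖ ^ 2 ≤ C}
  have hT : T.Finite := by
    have hf : (Metric.closedBall (0 : E3) (Real.sqrt C) ∩ (Λ : Set E3)).Finite := by
      have : DiscreteTopology (Λ : Set E3) := ‹DiscreteTopology Λ›
      have : DiscreteTopology Λ.toAddSubgroup := ‹DiscreteTopology Λ›
      exact Metric.finite_isBounded_inter_isClosed (IsDiscrete.mk ‹_›) Metric.isBounded_closedBall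
        (AddSubgroup.isClosed_of_discrete (H := Λ.toAddSubgroup))
    refine (Set.Finite.pi' fun _ : Fin 4 => hf).subset ?_
    rintro B ⟨hB, hC⟩ i
    refine ⟨?_, hmem hB i⟩
    rw [mem_closedBall_zero_iff]
    apply Real.le_sqrt_of_sq_le
    exact (Finset.single_le_sum (f := fun i => ‖B i‖ ^ 2) (fun _ _ => by positivity)
      (Finset.mem_univ i)).trans hC
  obtain ⟨B, ⟨hB, hBC⟩, hmin⟩ := Set.exists_min_image T (fun B => ∑ i, ‖B i‖ ^ 2) hT
    ⟨B₀, hB₀, le_rfl⟩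
  refine ⟨B, isObtuseSuperbase_iff.2 ⟨hB.1, hB.2, fun i j hij => ?_⟩⟩
  by_contra! hneg
  -- `sellingStep` is written for the pair (2, 3), so the acute pair is moved there.
  obtain ⟨σ, rfl, rfl⟩ : ∃ σ : Equiv.Perm (Fin 4), σ 2 = i ∧ σ 3 = j :=
    (by decide : ∀ i j : Fin 4, i ≠ j → ∃ σ : Equiv.Perm (Fin 4), σ 2 = i ∧ σ 3 = j) i j hij
  have hsum : ∑ i, (B ∘ σ) i = 0 := by rw [← hB.1]; exact Equiv.sum_comp σ B
  have hstep := sum_norm_sq_sellingStep hsum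
  have hle : ∑ i, ‖(B ∘ σ) i‖ ^ 2 = ∑ i, ‖B i‖ ^ 2 := Equiv.sum_comp σ fun i => ‖B i‖ ^ 2
  have hneg' : conorm (B ∘ σ) 2 3 < 0 := hneg
  have := hmin (sellingStep (B ∘ σ)) ⟨⟨sum_sellingStep hsum, by
    rw [span_sellingStep, Set.range_comp, σ.surjective.range_eq, Set.image_univ, hB.2]⟩,
    by linarith⟩
  linarith

/-! ## Coordinates and vonorms -/

/-- The basis of the lattice given by an obtuse superbase. -/
noncomputable def IsObtuseSuperbase.basis {Λ : Submodule ℤ E3} {B : Fin 4 → E3}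
    (h : IsObtuseSuperbase Λ B) : Module.Basis (Fin 3) ℤ Λ :=
  (Module.Basis.span (h.linearIndependent.restrict_scalars
    (by intro a b hab; simpa using hab))).map
    (LinearEquiv.ofEq _ _ h.span_eq)

theorem IsObtuseSuperbase.coe_basis {Λ : Submodule ℤ E3} {B : Fin 4 → E3}
    (h : IsObtuseSuperbase Λ B) (i : Fin 3) : (h.basis i : E3) = B i.succ := by
  have : (h.basis i : E3) = ![B 1, B 2, B 3] i := by
    rw [IsObtuseSuperbase.basis, Module.Basis.map_apply, LinearEquiv.coe_ofEq_apply,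
      Module.Basis.span_apply]
  rw [this]
  fin_cases i <;> rfl

theorem IsObtuseSuperbase.norm_sq_eq {Λ : Submodule ℤ E3} {B : Fin 4 → E3}
    (h : IsObtuseSuperbase Λ B) (x : Λ) :
    ‖(x : E3)‖ ^ 2 =
      conorm B 0 1 * (h.basis.repr x 0 : ℝ) ^ 2 + conorm B 0 2 * (h.basis.repr x 1 : ℝ) ^ 2 +
      conorm B 0 3 * (h.basis.repr x 2 : ℝ) ^ 2 +
      conorm B 1 2 * (h.basis.repr x 0 - h.basis.repr x 1 : ℝ) ^ 2 +
      conorm B 1 3 * (h.basis.repr x 0 - h.basis.repr x 2 : ℝ) ^ 2 +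
      conorm B 2 3 * (h.basis.repr x 1 - h.basis.repr x 2 : ℝ) ^ 2 := by
  -- Coefficients over a superbase are determined only up to a common constant; the one of `B 0` is
  -- normalised to zero.
  have hx : (x : E3) = ∑ i, (Fin.cons 0 fun i => (h.basis.repr x i : ℝ) : Fin 4 → ℝ) i • B i := by
    conv_lhs => rw [← h.basis.sum_repr x]
    rw [Fin.sum_univ_succ (n := 3), Fin.cons_zero, zero_smul, zero_add, Submodule.coe_sum]
    refine Finset.sum_congr rfl fun i _ => ?_
    rw [Fin.cons_succ, Submodule.coe_smul, h.coe_basis, Int.cast_smul_eq_zsmul]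
  rw [hx, norm_sq_sum_smul h.sum_eq_zero]
  have h1 : (Fin.cons 0 fun i => (h.basis.repr x i : ℝ) : Fin 4 → ℝ) 1 = h.basis.repr x 0 := rfl
  have h2 : (Fin.cons 0 fun i => (h.basis.repr x i : ℝ) : Fin 4 → ℝ) 2 = h.basis.repr x 1 := rfl
  have h3 : (Fin.cons 0 fun i => (h.basis.repr x i : ℝ) : Fin 4 → ℝ) 3 = h.basis.repr x 2 := rfl
  rw [h1, h2, h3, Fin.cons_zero]
  ring

/-! ### The Fano plane of characters modulo 2, and vonorms -/

/-- The character modulo 2 (in coordinates `1, 2, 3`) with support `{i, j}`. -/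
def edge (i j : Fin 4) : Fin 3 → ZMod 2 := fun k =>
  (if k.succ = i then 1 else 0) + if k.succ = j then 1 else 0

/-- A function of pairs of indices as a function on the Fano plane, with value zero at the
character with full support. -/
def fanoValue (f : Fin 4 → Fin 4 → ℝ) (χ : Fin 3 → ZMod 2) : ℝ :=
  if χ = edge 0 1 then f 0 1 else if χ = edge 0 2 then f 0 2 else if χ = edge 0 3 then f 0 3
  else if χ = edge 1 2 then f 1 2 else if χ = edge 1 3 then f 1 3
  else if χ = edge 2 3 then f 2 3 else 0

theorem eq_edge_or (χ : Fin 3 → ZMod 2) : χ = 0 ∨ χ = 1 ∨ χ = edge 0 1 ∨ χ = edge 0 2 ∨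
    χ = edge 0 3 ∨ χ = edge 1 2 ∨ χ = edge 1 3 ∨ χ = edge 2 3 := by
  revert χ; decide

section fanoValue
variable (f : Fin 4 → Fin 4 → ℝ)

theorem fanoValue_zero : fanoValue f 0 = 0 := by
  simp only [fanoValue]; repeat rw [if_neg (by decide)]
theorem fanoValue_one : fanoValue f 1 = 0 := by
  simp only [fanoValue]; repeat rw [if_neg (by decide)]
theorem fanoValue_edge01 : fanoValue f (edge 0 1) = f 0 1 := by
  rw [fanoValue, if_pos rfl]
theorem fanoValue_edge02 : fanoValue f (edge 0 2) = f 0 2 := by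
  rw [fanoValue, if_neg (by decide), if_pos rfl]
theorem fanoValue_edge03 : fanoValue f (edge 0 3) = f 0 3 := by
  rw [fanoValue, if_neg (by decide), if_neg (by decide), if_pos rfl]
theorem fanoValue_edge12 : fanoValue f (edge 1 2) = f 1 2 := by
  rw [fanoValue, if_neg (by decide), if_neg (by decide), if_neg (by decide), if_pos rfl]
theorem fanoValue_edge13 : fanoValue f (edge 1 3) = f 1 3 := by
  rw [fanoValue, if_neg (by decide), if_neg (by decide), if_neg (by decide), if_neg (by decide),
    if_pos rfl]
theorem fanoValue_edge23 : fanoValue f (edge 2 3) = f 2 3 := by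
  rw [fanoValue, if_neg (by decide), if_neg (by decide), if_neg (by decide), if_neg (by decide),
    if_neg (by decide), if_pos rfl]

end fanoValue

theorem sqrt_fanoValue_conorm (B : Fin 4 → E3) (χ : Fin 3 → ZMod 2) :
    Real.sqrt (fanoValue (conorm B) χ) = fanoValue (rootProduct B) χ := by
  unfold fanoValue
  split_ifs <;> first | rfl | exact Real.sqrt_zero

/-- The smallest squared norm in a class of `Λ / 2Λ`. -/
noncomputable def vonorm (B : Fin 4 → E3) (n : Fin 3 → ZMod 2) : ℝ :=
  ∑ χ, if χ ⬝ᵥ n = 1 then fanoValue (conorm B) χ else 0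

theorem univ_fano : (Finset.univ : Finset (Fin 3 → ZMod 2)) = {0, 1, edge 0 1, edge 0 2,
    edge 0 3, edge 1 2, edge 1 3, edge 2 3} := by decide

/-- A class `n` cuts the index set into two parts, index 0 having value 0, and its vonorm is the
total conorm of the pairs separated by the cut. -/
theorem vonorm_eq (B : Fin 4 → E3) (n : Fin 3 → ZMod 2) :
    vonorm B n = (if n 0 = 1 then conorm B 0 1 else 0) + (if n 1 = 1 then conorm B 0 2 else 0) +
      (if n 2 = 1 then conorm B 0 3 else 0) + (if n 0 ≠ n 1 then conorm B 1 2 else 0) +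
      (if n 0 ≠ n 2 then conorm B 1 3 else 0) + (if n 1 ≠ n 2 then conorm B 2 3 else 0) := by
  have e1 : edge 0 1 ⬝ᵥ n = 1 ↔ n 0 = 1 := by revert n; decide
  have e2 : edge 0 2 ⬝ᵥ n = 1 ↔ n 1 = 1 := by revert n; decide
  have e3 : edge 0 3 ⬝ᵥ n = 1 ↔ n 2 = 1 := by revert n; decide
  have e4 : edge 1 2 ⬝ᵥ n = 1 ↔ n 0 ≠ n 1 := by revert n; decide
  have e5 : edge 1 3 ⬝ᵥ n = 1 ↔ n 0 ≠ n 2 := by revert n; decide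
  have e6 : edge 2 3 ⬝ᵥ n = 1 ↔ n 1 ≠ n 2 := by revert n; decide
  rw [vonorm, univ_fano]
  repeat rw [Finset.sum_insert (by decide)]
  rw [Finset.sum_singleton]
  simp only [e1, e2, e3, e4, e5, e6, fanoValue_zero, fanoValue_one, ite_self, fanoValue_edge01,
    fanoValue_edge02, fanoValue_edge03, fanoValue_edge12, fanoValue_edge13, fanoValue_edge23]
  ring

/-- Reduction of the coordinates of a lattice vector modulo 2. -/
noncomputable def IsObtuseSuperbase.coordMod {Λ : Submodule ℤ E3} {B : Fin 4 → E3}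
    (h : IsObtuseSuperbase Λ B) (x : Λ) : Fin 3 → ZMod 2 := fun i => (h.basis.repr x i : ZMod 2)

theorem ite_cast_eq_one_le {p : ℝ} (hp : 0 ≤ p) (a : ℤ) :
    (if (a : ZMod 2) = 1 then p else 0) ≤ p * (a : ℝ) ^ 2 := by
  split_ifs with h
  · have h0 : a ≠ 0 := by rintro rfl; revert h; decide
    have h1 : (1 : ℝ) ≤ (a : ℝ) ^ 2 := by
      exact_mod_cast Int.add_one_le_iff.2 (by positivity : 0 < a ^ 2)
    nlinarith
  · positivity

theorem ite_cast_ne_le {p : ℝ} (hp : 0 ≤ p) (a b : ℤ) :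
    (if (a : ZMod 2) ≠ b then p else 0) ≤ p * (a - b : ℝ) ^ 2 := by
  have h := ite_cast_eq_one_le hp (a - b)
  push_cast at h
  have e : ∀ u v : ZMod 2, u ≠ v ↔ u - v = 1 := by decide
  simpa only [e] using h

/-- Holds term by term in Selling's formula, as an odd integer has square at least 1 and the conorms
are non-negative. -/
theorem IsObtuseSuperbase.vonorm_le {Λ : Submodule ℤ E3} {B : Fin 4 → E3}
    (h : IsObtuseSuperbase Λ B) (x : Λ) : vonorm B (h.coordMod x) ≤ ‖(x : E3)‖ ^ 2 := by
  rw [vonorm_eq, h.norm_sq_eq]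
  have c {i j : Fin 4} (hij : i ≠ j) := h.conorm_nonneg hij
  gcongr
  · exact ite_cast_eq_one_le (c (by decide)) _
  · exact ite_cast_eq_one_le (c (by decide)) _
  · exact ite_cast_eq_one_le (c (by decide)) _
  · exact ite_cast_ne_le (c (by decide)) _ _
  · exact ite_cast_ne_le (c (by decide)) _ _
  · exact ite_cast_ne_le (c (by decide)) _ _

/-- With coordinates 0 or 1 all differences lie in `{-1, 0, 1}`, so every term of Selling's formula
is minimal at once. -/
theorem IsObtuseSuperbase.exists_norm_sq_eq_vonorm {Λ : Submodule ℤ E3} {B : Fin 4 → E3}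
    (h : IsObtuseSuperbase Λ B) (x : Λ) :
    ∃ y : Λ, ‖((x + (2 : ℤ) • y : Λ) : E3)‖ ^ 2 = vonorm B (h.coordMod x) := by
  let n := h.basis.repr x
  -- Subtracting twice the integer quotients by 2 leaves the remainders modulo 2 as coordinates.
  refine ⟨-∑ i, (n i / 2) • h.basis i, ?_⟩
  have hr (i : Fin 3) : h.basis.repr (x + (2 : ℤ) • -∑ i, (n i / 2) • h.basis i) i = n i % 2 := by
    rw [map_add, map_smul, map_neg, Finsupp.add_apply, Finsupp.smul_apply, Finsupp.neg_apply,
      h.basis.repr_sum_self fun i => n i / 2]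
    simp only [smul_eq_mul, n]
    omega
  rw [h.norm_sq_eq, vonorm_eq]
  simp only [hr]
  have hc (i : Fin 3) : h.coordMod x i = ((n i % 2 : ℤ) : ZMod 2) := by
    rw [IsObtuseSuperbase.coordMod, ZMod.intCast_eq_intCast_iff]
    exact (Int.mod_modEq _ _).symm
  simp only [hc]
  obtain h0 | h0 := Int.emod_two_eq_zero_or_one (n 0) <;>
  obtain h1 | h1 := Int.emod_two_eq_zero_or_one (n 1) <;>
  obtain h2 | h2 := Int.emod_two_eq_zero_or_one (n 2) <;>
  simp [h0, h1, h2]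

theorem IsObtuseSuperbase.coordMod_add {Λ : Submodule ℤ E3} {B : Fin 4 → E3}
    (h : IsObtuseSuperbase Λ B) (x y : Λ) : h.coordMod (x + (2 : ℤ) • y) = h.coordMod x := by
  ext i
  simp only [IsObtuseSuperbase.coordMod, map_add, map_smul, Finsupp.add_apply, Finsupp.smul_apply,
    smul_eq_mul]
  push_cast
  rw [show (2 : ZMod 2) = 0 from rfl, zero_mul, add_zero]

/-- Both sides are the minimum of the squared norm on the class of `x` modulo `2Λ`, which knows
nothing of the superbase. -/
theorem IsObtuseSuperbase.vonorm_eq_vonorm {Λ : Submodule ℤ E3} {B B' : Fin 4 → E3}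
    (h : IsObtuseSuperbase Λ B) (h' : IsObtuseSuperbase Λ B') (x : Λ) :
    vonorm B (h.coordMod x) = vonorm B' (h'.coordMod x) := by
  apply le_antisymm
  · obtain ⟨y, hy⟩ := h'.exists_norm_sq_eq_vonorm x
    rw [← hy, ← h.coordMod_add x y]
    exact h.vonorm_le _
  · obtain ⟨y, hy⟩ := h.exists_norm_sq_eq_vonorm x
    rw [← hy, ← h'.coordMod_add x y]
    exact h'.vonorm_le _

/-- Fourier inversion on `(ℤ/2)³`: a nonzero `η` takes the value 1 on four vectors, on all of which
the sign is positive if `χ = η`, while the signs cancel if `χ ≠ η`. So the vonorms determine the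
conorms. -/
theorem sum_vonorm (B : Fin 4 → E3) {χ : Fin 3 → ZMod 2} (hχ : χ ≠ 0) :
    ∑ n, (if χ ⬝ᵥ n = 1 then vonorm B n else -vonorm B n) = 4 * fanoValue (conorm B) χ := by
  have key : ∀ χ η : Fin 3 → ZMod 2, χ ≠ 0 → η ≠ 0 →
      ∑ n, (if χ ⬝ᵥ n = 1 then (1 : ℤ) else -1) * (if η ⬝ᵥ n = 1 then 1 else 0) =
        if χ = η then 4 else 0 := by decide
  have key' (η : Fin 3 → ZMod 2) : (∑ n, (if χ ⬝ᵥ n = 1 then (1 : ℝ) else -1) *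
      (if η ⬝ᵥ n = 1 then 1 else 0)) * fanoValue (conorm B) η =
        if χ = η then 4 * fanoValue (conorm B) η else 0 := by
    by_cases hη : η = 0
    · subst hη
      rw [if_neg hχ, fanoValue_zero, mul_zero]
    · have := congrArg (Int.cast : ℤ → ℝ) (key χ η hχ hη)
      push_cast at this
      rw [this]
      split_ifs <;> simp
  calc _ = ∑ n, ∑ η, ((if χ ⬝ᵥ n = 1 then (1 : ℝ) else -1) * (if η ⬝ᵥ n = 1 then 1 else 0)) *
          fanoValue (conorm B) η := by
        refine Finset.sum_congr rfl fun n _ => ?_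
        simp only [mul_assoc]
        rw [← Finset.mul_sum, vonorm]
        simp only [ite_mul, one_mul, zero_mul, neg_mul]
    _ = ∑ η, if χ = η then 4 * fanoValue (conorm B) η else 0 := by
        rw [Finset.sum_comm]
        simp only [← Finset.sum_mul, key']
    _ = _ := by simp

/-- The root products of two obtuse superbases of a lattice, considered as functions on the Fano
plane, differ by a collineation. -/
theorem IsObtuseSuperbase.exists_collineation {Λ : Submodule ℤ E3} {B B' : Fin 4 → E3}
    (h : IsObtuseSuperbase Λ B) (h' : IsObtuseSuperbase Λ B') :
    ∃ φ : (Fin 3 → ZMod 2) →+ (Fin 3 → ZMod 2), Function.Injective φ ∧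
      ∀ χ, fanoValue (rootProduct B) (φ χ) = fanoValue (rootProduct B') χ := by
  let M : Matrix (Fin 3) (Fin 3) (ZMod 2) := (h.basis.toMatrix h'.basis).map (Int.castRingHom _)
  let N : Matrix (Fin 3) (Fin 3) (ZMod 2) := (h'.basis.toMatrix h.basis).map (Int.castRingHom _)
  have hMN : M * N = 1 := by
    simp only [M, N]
    rw [← Matrix.map_mul, h.basis.toMatrix_mul_toMatrix_flip, Matrix.map_one _ (by simp) (by simp)]
  have hNM : N * M = 1 := by
    simp only [M, N]
    rw [← Matrix.map_mul, h'.basis.toMatrix_mul_toMatrix_flip, Matrix.map_one _ (by simp) (by simp)]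
  have hM (x : Λ) : M.mulVec (h'.coordMod x) = h.coordMod x := by
    have := h'.basis.toMatrix_mulVec_repr h.basis x
    ext i
    have hi := congrArg (Int.castRingHom (ZMod 2)) (congrFun this i)
    rw [RingHom.map_mulVec] at hi
    exact hi
  -- `M` is the change of coordinates modulo 2 from `B'` to `B`, and vonorms do not depend on
  -- coordinates.
  have hG (n : Fin 3 → ZMod 2) : vonorm B' n = vonorm B (M.mulVec n) := by
    obtain ⟨x, rfl⟩ : ∃ x, h'.coordMod x = n := by
      refine ⟨∑ i, ((n i).val : ℤ) • h'.basis i, ?_⟩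
      ext i
      rw [IsObtuseSuperbase.coordMod, h'.basis.repr_sum_self fun i => ((n i).val : ℤ)]
      simp
    rw [hM, h.vonorm_eq_vonorm h']
  have hinj : Function.Injective (fun χ : Fin 3 → ZMod 2 => Matrix.vecMul χ N) := by
    intro a b hab
    have := congrArg (fun v => Matrix.vecMul v M) hab
    simpa [Matrix.vecMul_vecMul, hNM] using this
  -- Characters transform contragrediently: a character `χ` in the coordinates of `B'` is `χ N` in
  -- those of `B`, where `N` is the inverse of `M`.
  refine ⟨⟨⟨fun χ => Matrix.vecMul χ N, Matrix.zero_vecMul _⟩, fun a b => Matrix.add_vecMul N a b⟩,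
    hinj, fun χ => ?_⟩
  change fanoValue (rootProduct B) (Matrix.vecMul χ N) = _
  by_cases hχ : χ = 0
  · subst hχ
    rw [Matrix.zero_vecMul, fanoValue_zero, fanoValue_zero]
  have hχ' : Matrix.vecMul χ N ≠ 0 := fun h0 => hχ (hinj (by simpa using h0))
  rw [← sqrt_fanoValue_conorm, ← sqrt_fanoValue_conorm]
  congr 1
  have e1 := sum_vonorm B hχ'
  have e2 := sum_vonorm B' hχ
  have e : ∑ n, (if Matrix.vecMul χ N ⬝ᵥ n = 1 then vonorm B n else -vonorm B n) =
      ∑ n, (if χ ⬝ᵥ n = 1 then vonorm B' n else -vonorm B' n) := by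
    let e : (Fin 3 → ZMod 2) ≃ (Fin 3 → ZMod 2) :=
      ⟨M.mulVec, N.mulVec, fun v => by simp [hNM], fun v => by simp [hMN]⟩
    refine (Fintype.sum_equiv e _ _ fun n => ?_).symm
    have : Matrix.vecMul χ N ⬝ᵥ e n = χ ⬝ᵥ n := by
      change Matrix.vecMul χ N ⬝ᵥ M.mulVec n = _
      rw [Matrix.dotProduct_mulVec, Matrix.vecMul_vecMul, hNM, Matrix.vecMul_one]
    rw [this, hG]
    rfl
  linarith

/-! ## Root products up to reordering and Selling's transformation -/

/-- `Λ` has an obtuse superbase with the given root products. -/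
def HasRootProducts (Λ : Submodule ℤ E3) (r23 r13 r12 r01 r02 r03 : ℝ) : Prop :=
  ∃ B, IsObtuseSuperbase Λ B ∧ rootProduct B 2 3 = r23 ∧ rootProduct B 1 3 = r13 ∧
    rootProduct B 1 2 = r12 ∧ rootProduct B 0 1 = r01 ∧ rootProduct B 0 2 = r02 ∧
    rootProduct B 0 3 = r03

namespace HasRootProducts

variable {Λ : Submodule ℤ E3} [DiscreteTopology Λ] [IsZLattice ℝ Λ] {a b c d e f : ℝ}

theorem swap01 (h : HasRootProducts Λ a b c d e f) : HasRootProducts Λ a f e d c b := by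
  obtain ⟨B, hB, rfl, rfl, rfl, rfl, rfl, rfl⟩ := h
  exact ⟨B ∘ Equiv.swap 0 1, hB.comp_perm _, rfl, rfl, rfl, rootProduct_comm B 1 0, rfl, rfl⟩

theorem swap12 (h : HasRootProducts Λ a b c d e f) : HasRootProducts Λ b a c e d f := by
  obtain ⟨B, hB, rfl, rfl, rfl, rfl, rfl, rfl⟩ := h
  exact ⟨B ∘ Equiv.swap 1 2, hB.comp_perm _, rfl, rfl, rootProduct_comm B 2 1, rfl, rfl, rfl⟩

theorem swap23 (h : HasRootProducts Λ a b c d e f) : HasRootProducts Λ a c b d f e := by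
  obtain ⟨B, hB, rfl, rfl, rfl, rfl, rfl, rfl⟩ := h
  exact ⟨B ∘ Equiv.swap 2 3, hB.comp_perm _, rootProduct_comm B 3 2, rfl, rfl, rfl, rfl, rfl⟩

/-- Exchanges the rows in the first and third columns of the root form. When both entries of the
first column vanish this leaves them zero, so that `twist` applies again to other entries. -/
theorem rotate (h : HasRootProducts Λ a b c d e f) : HasRootProducts Λ d b f a e c :=
  h.swap12.swap01.swap23.swap12

/-- Selling's transformation at an orthogonal pair keeps the superbase obtuse. It interchanges two
entries of one column only, which no reordering of the four vectors does in general. -/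
theorem twist (h : HasRootProducts Λ 0 b c d e f) : HasRootProducts Λ 0 b e d c f := by
  obtain ⟨B, hB, h0, rfl, rfl, rfl, rfl, rfl⟩ := h
  have h23 : conorm B 2 3 = 0 := by
    rw [← hB.rootProduct_sq (by decide), h0]; norm_num
  have hs := conorm_sellingStep hB.sum_eq_zero h23
  obtain ⟨h1, h2, h3, h4, h5, h6⟩ := hs
  have c {i j : Fin 4} (hij : i ≠ j) := hB.conorm_nonneg hij
  have hpos : ∀ i j, i ≠ j → 0 ≤ conorm (sellingStep B) i j := by
    have hlt : ∀ i j, i < j → 0 ≤ conorm (sellingStep B) i j := by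
      intro i j hij
      fin_cases i <;> fin_cases j <;> first | exact absurd hij (by decide) | skip
      · exact h4 ▸ c (by decide)
      · exact h5 ▸ c (by decide)
      · exact h6 ▸ c (by decide)
      · exact h3 ▸ c (by decide)
      · exact h2 ▸ c (by decide)
      · exact h1.ge
    intro i j hij
    rcases hij.lt_or_gt with h | h
    · exact hlt i j h
    · rw [conorm_comm]; exact hlt j i h
  refine ⟨sellingStep B, isObtuseSuperbase_iff.2 ⟨sum_sellingStep hB.sum_eq_zero, ?_, hpos⟩,
    ?_, congrArg Real.sqrt h2, congrArg Real.sqrt h3, congrArg Real.sqrt h4,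
    congrArg Real.sqrt h5, congrArg Real.sqrt h6⟩
  · rw [span_sellingStep, (isObtuseSuperbase_iff.1 hB).2.1]
  · exact (congrArg Real.sqrt h1).trans Real.sqrt_zero

end HasRootProducts

/-! ## Unordered and ordered tuples -/

/-- Adjacent transpositions generate all permutations, so a property stable under them passes
between tuples with equal multisets. The versions for three and four entries are applied to
`HasRootProducts`. -/
theorem pair_rec {P : ℝ → ℝ → Prop} (h : ∀ a b, P a b → P b a) {a b a' b' : ℝ}
    (he : ({a, b} : Multiset ℝ) = {a', b'}) (hP : P a b) : P a' b' := by
  have ha : a' ∈ ({a, b} : Multiset ℝ) := by rw [he]; simp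
  simp only [Multiset.insert_eq_cons, Multiset.mem_cons, Multiset.mem_singleton] at ha
  rcases ha with rfl | rfl
  · rw [Multiset.insert_eq_cons, Multiset.insert_eq_cons, Multiset.cons_inj_right] at he
    rwa [← Multiset.singleton_inj.1 he]
  · rw [Multiset.pair_comm, Multiset.insert_eq_cons, Multiset.insert_eq_cons,
      Multiset.cons_inj_right] at he
    rw [← Multiset.singleton_inj.1 he]
    exact h _ _ hP

theorem triple_rec {P : ℝ → ℝ → ℝ → Prop} (h₁ : ∀ a b c, P a b c → P b a c)
    (h₂ : ∀ a b c, P a b c → P a c b) {a b c a' b' c' : ℝ}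
    (he : ({a, b, c} : Multiset ℝ) = {a', b', c'}) (hP : P a b c) : P a' b' c' := by
  have ha : a' ∈ ({a, b, c} : Multiset ℝ) := by rw [he]; simp
  simp only [Multiset.insert_eq_cons, Multiset.mem_cons, Multiset.mem_singleton] at ha
  simp only [Multiset.insert_eq_cons] at he
  rcases ha with rfl | rfl | rfl
  · rw [Multiset.cons_inj_right] at he
    exact pair_rec (P := P a') (h₂ a') he hP
  · rw [Multiset.cons_swap, Multiset.cons_inj_right] at he
    exact pair_rec (P := P a') (h₂ a') he (h₁ _ _ _ hP)
  · rw [← Multiset.insert_eq_cons b, Multiset.pair_comm, Multiset.insert_eq_cons,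
      Multiset.cons_swap, Multiset.cons_inj_right] at he
    exact pair_rec (P := P a') (h₂ a') he (h₁ _ _ _ (h₂ _ _ _ hP))

theorem quadruple_rec {P : ℝ → ℝ → ℝ → ℝ → Prop} (h₁ : ∀ a b c d, P a b c d → P b a c d)
    (h₂ : ∀ a b c d, P a b c d → P a c b d) (h₃ : ∀ a b c d, P a b c d → P a b d c)
    {a b c d a' b' c' d' : ℝ}
    (he : ({a, b, c, d} : Multiset ℝ) = {a', b', c', d'}) (hP : P a b c d) : P a' b' c' d' := by
  have ha : a' ∈ ({a, b, c, d} : Multiset ℝ) := by rw [he]; simp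
  simp only [Multiset.insert_eq_cons, Multiset.mem_cons, Multiset.mem_singleton] at ha
  simp only [Multiset.insert_eq_cons] at he
  rcases ha with rfl | rfl | rfl | rfl
  · rw [Multiset.cons_inj_right] at he
    exact triple_rec (P := P a') (h₂ a') (h₃ a') he hP
  · rw [Multiset.cons_swap, Multiset.cons_inj_right] at he
    exact triple_rec (P := P a') (h₂ a') (h₃ a') he (h₁ _ _ _ _ hP)
  · rw [Multiset.cons_swap b, Multiset.cons_swap a, Multiset.cons_inj_right] at he
    exact triple_rec (P := P a') (h₂ a') (h₃ a') he (h₁ _ _ _ _ (h₂ _ _ _ _ hP))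
  · rw [← Multiset.insert_eq_cons c, Multiset.pair_comm, Multiset.insert_eq_cons,
      Multiset.cons_swap b, Multiset.cons_swap a, Multiset.cons_inj_right] at he
    exact triple_rec (P := P a') (h₂ a') (h₃ a') he
      (h₁ _ _ _ _ (h₂ _ _ _ _ (h₃ _ _ _ _ hP)))

theorem triple_unique {a b c a' b' c' : ℝ} (he : ({a, b, c} : Multiset ℝ) = {a', b', c'})
    (h1 : a ≤ b) (h2 : b ≤ c) (h1' : a' ≤ b') (h2' : b' ≤ c') : a = a' ∧ b = b' ∧ c = c' := by
  have hp : [a, b, c].Perm [a', b', c'] := Multiset.coe_eq_coe.1 he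
  have h : [a, b, c] = [a', b', c'] :=
    hp.eq_of_pairwise' (r := (· ≤ ·)) (by simp; refine ⟨⟨?_, ?_⟩, ?_⟩ <;> linarith)
      (by simp; refine ⟨⟨?_, ?_⟩, ?_⟩ <;> linarith)
  simpa using h

theorem quadruple_unique {a b c d a' b' c' d' : ℝ}
    (he : ({a, b, c, d} : Multiset ℝ) = {a', b', c', d'})
    (h1 : a ≤ b) (h2 : b ≤ c) (h3 : c ≤ d) (h1' : a' ≤ b') (h2' : b' ≤ c') (h3' : c' ≤ d') :
    a = a' ∧ b = b' ∧ c = c' ∧ d = d' := by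
  have hp : [a, b, c, d].Perm [a', b', c', d'] := Multiset.coe_eq_coe.1 he
  have h : [a, b, c, d] = [a', b', c', d'] :=
    hp.eq_of_pairwise' (r := (· ≤ ·))
      (by simp; refine ⟨⟨?_, ?_, ?_⟩, ⟨?_, ?_⟩, ?_⟩ <;> linarith)
      (by simp; refine ⟨⟨?_, ?_, ?_⟩, ⟨?_, ?_⟩, ?_⟩ <;> linarith)
  simpa using h

theorem exists_sorted_triple (x y z : ℝ) : ∃ a b c : ℝ,
    ({x, y, z} : Multiset ℝ) = {a, b, c} ∧ a ≤ b ∧ b ≤ c := by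
  have hs := Multiset.pairwise_sort ({x, y, z} : Multiset ℝ) (· ≤ ·)
  have hl := Multiset.length_sort (s := ({x, y, z} : Multiset ℝ)) (· ≤ ·)
  have he := Multiset.sort_eq ({x, y, z} : Multiset ℝ) (· ≤ ·)
  match h : Multiset.sort ({x, y, z} : Multiset ℝ) (· ≤ ·), hl with
  | [a, b, c], _ =>
    rw [h] at hs he
    simp only [List.pairwise_cons, List.mem_cons] at hs
    exact ⟨a, b, c, he.symm, hs.1 b (by simp), hs.2.1 c (by simp)⟩

theorem exists_sorted_quadruple (x y z w : ℝ) : ∃ a b c d : ℝ,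
    ({x, y, z, w} : Multiset ℝ) = {a, b, c, d} ∧ a ≤ b ∧ b ≤ c ∧ c ≤ d := by
  have hs := Multiset.pairwise_sort ({x, y, z, w} : Multiset ℝ) (· ≤ ·)
  have hl := Multiset.length_sort (s := ({x, y, z, w} : Multiset ℝ)) (· ≤ ·)
  have he := Multiset.sort_eq ({x, y, z, w} : Multiset ℝ) (· ≤ ·)
  match h : Multiset.sort ({x, y, z, w} : Multiset ℝ) (· ≤ ·), hl with
  | [a, b, c, d], _ =>
    rw [h] at hs he
    simp only [List.pairwise_cons, List.mem_cons] at hs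
    exact ⟨a, b, c, d, he.symm, hs.1 b (by simp), hs.2.1 c (by simp), hs.2.2.1 d (by simp)⟩

/-- Two pairs of opposite corners of a square, ordered by the symmetries of the square. -/
theorem exists_sorted_square (x y z w : ℝ) : ∃ a b c d : ℝ,
    s(s(x, y), s(z, w)) = s(s(a, d), s(b, c)) ∧ a ≤ d ∧ a ≤ b ∧ b ≤ c ∧ (a = b → c ≤ d) := by
  wlog hxy : x ≤ y generalizing x y
  · rw [Sym2.eq_swap (a := x)]
    exact this y x (le_of_not_ge hxy)
  wlog hzw : z ≤ w generalizing z w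
  · rw [Sym2.eq_swap (a := z)]
    exact this w z (le_of_not_ge hzw)
  rcases lt_trichotomy x z with h | rfl | h
  · exact ⟨x, z, w, y, rfl, hxy, h.le, hzw, fun h' => absurd h' h.ne⟩
  · rcases le_total w y with h | h
    · exact ⟨x, x, w, y, rfl, hxy, le_rfl, hzw, fun _ => h⟩
    · exact ⟨x, x, y, w, Sym2.eq_swap, hzw, le_rfl, hxy, fun _ => h⟩
  · exact ⟨z, x, y, w, Sym2.eq_swap, hzw, h.le, hxy, fun h' => absurd h' h.ne⟩

/-- If the two diagonals are interchanged, their smaller ends must agree, and then the tie-breaking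
conditions force the larger ends to agree too. -/
theorem square_unique {a b c d a' b' c' d' : ℝ}
    (he : s(s(a, d), s(b, c)) = s(s(a', d'), s(b', c')))
    (h1 : a ≤ d) (h2 : a ≤ b) (h3 : b ≤ c) (h4 : a = b → c ≤ d)
    (h1' : a' ≤ d') (h2' : a' ≤ b') (h3' : b' ≤ c') (h4' : a' = b' → c' ≤ d') :
    a = a' ∧ b = b' ∧ c = c' ∧ d = d' := by
  have hpair {p q r s : ℝ} (h : s(p, q) = s(r, s)) (h1 : p ≤ q) (h2 : r ≤ s) :
      p = r ∧ q = s := by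
    rcases Sym2.eq_iff.1 h with h | ⟨rfl, rfl⟩
    · exact h
    · exact ⟨le_antisymm h1 h2, le_antisymm h2 h1⟩
  rcases Sym2.eq_iff.1 he with ⟨e, e'⟩ | ⟨e, e'⟩
  · obtain ⟨rfl, rfl⟩ := hpair e h1 h1'
    obtain ⟨rfl, rfl⟩ := hpair e' h3 h3'
    simp
  · obtain ⟨rfl, rfl⟩ := hpair e h1 h3'
    obtain ⟨rfl, rfl⟩ := hpair e' h3 h1'
    obtain rfl := le_antisymm h2 h2'
    have := h4 rfl
    have := h4' rfl
    refine ⟨rfl, rfl, ?_, ?_⟩ <;> linarith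

/-! ## Root invariants without the Voronoi type -/

/-- The part of `IsRootInvariant` which only depends on root products. -/
def IsRootData (B : Fin 4 → E3) : RootInvariant → Prop
  | .V1 M =>
      (∀ i j, i ≠ j → rootProduct B i j ≠ 0) ∧
      (∃ σ : Equiv.Perm (Fin 4), M = rootForm (B ∘ σ)) ∧
      ∀ σ : Equiv.Perm (Fin 4), rowLex M ≤ rowLex (rootForm (B ∘ σ))
  | .V2 r01 r13 r12 r02 r03 =>
      (∃ σ : Equiv.Perm (Fin 4),
        rootProduct (B ∘ σ) 2 3 = 0 ∧
        rootProduct (B ∘ σ) 0 1 = r01 ∧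
        s(s(rootProduct (B ∘ σ) 1 3, rootProduct (B ∘ σ) 0 3),
          s(rootProduct (B ∘ σ) 1 2, rootProduct (B ∘ σ) 0 2)) = s(s(r13, r03), s(r12, r02))) ∧
      0 < r01 ∧ 0 < r13 ∧ r13 ≤ r03 ∧ r13 ≤ r12 ∧ r12 ≤ r02 ∧ (r13 = r12 → r02 ≤ r03)
  | .V3 a b c d =>
      (∃ σ : Equiv.Perm (Fin 4),
        rootProduct (B ∘ σ) 2 3 = 0 ∧ rootProduct (B ∘ σ) 0 1 = 0 ∧
        ({rootProduct (B ∘ σ) 1 3, rootProduct (B ∘ σ) 1 2, rootProduct (B ∘ σ) 0 2,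
          rootProduct (B ∘ σ) 0 3} : Multiset ℝ) = {a, b, c, d}) ∧
      0 < a ∧ a ≤ b ∧ b ≤ c ∧ c ≤ d
  | .V4 a b c r03 =>
      (∃ σ : Equiv.Perm (Fin 4),
        rootProduct (B ∘ σ) 2 3 = 0 ∧ rootProduct (B ∘ σ) 1 3 = 0 ∧
        ({rootProduct (B ∘ σ) 1 2, rootProduct (B ∘ σ) 0 1,
          rootProduct (B ∘ σ) 0 2} : Multiset ℝ) = {a, b, c} ∧
        rootProduct (B ∘ σ) 0 3 = r03) ∧
      0 < r03 ∧ 0 < a ∧ a ≤ b ∧ b ≤ c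
  | .V5 a b c =>
      ({rootProduct B 2 3, rootProduct B 1 3, rootProduct B 1 2,
        rootProduct B 0 1, rootProduct B 0 2, rootProduct B 0 3} : Multiset ℝ) =
          {0, 0, 0, a, b, c} ∧
      0 < a ∧ a ≤ b ∧ b ≤ c

/-- The positivity and order conditions on the entries of a root invariant (only positivity for
the type `V1`). -/
def RootInvariant.IsOrdered : RootInvariant → Prop
  | .V1 M => ∀ i j, 0 < M i j
  | .V2 r01 r13 r12 r02 r03 =>
      0 < r01 ∧ 0 < r13 ∧ r13 ≤ r03 ∧ r13 ≤ r12 ∧ r12 ≤ r02 ∧ (r13 = r12 → r02 ≤ r03)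
  | .V3 a b c d => 0 < a ∧ a ≤ b ∧ b ≤ c ∧ c ≤ d
  | .V4 a b c r03 => 0 < r03 ∧ 0 < a ∧ a ≤ b ∧ b ≤ c
  | .V5 a b c => 0 < a ∧ a ≤ b ∧ b ≤ c

/-- The root products of `B` are read off from `ρ`. -/
def IsNormal (B : Fin 4 → E3) (ρ : RootInvariant) : Prop :=
  let P (r23 r13 r12 r01 r02 r03 : ℝ) : Prop := rootProduct B 2 3 = r23 ∧ rootProduct B 1 3 = r13 ∧
    rootProduct B 1 2 = r12 ∧ rootProduct B 0 1 = r01 ∧ rootProduct B 0 2 = r02 ∧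
    rootProduct B 0 3 = r03
  match ρ with
  | .V1 M => P (M 0 0) (M 0 1) (M 0 2) (M 1 0) (M 1 1) (M 1 2)
  | .V2 r01 r13 r12 r02 r03 => P 0 r13 r12 r01 r02 r03
  | .V3 a b c d => P 0 a b 0 c d
  | .V4 a b c r03 => P 0 0 a b c r03
  | .V5 a b c => P 0 0 0 a b c

/-- `Λ` has an obtuse superbase whose root products are read off from `ρ`. -/
def HasNormalForm (Λ : Submodule ℤ E3) (ρ : RootInvariant) : Prop :=
  ∃ B, IsObtuseSuperbase Λ B ∧ IsNormal B ρ

/-- A permutation of four indices permutes the six unordered pairs; the root product is a function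
of such pairs. -/
theorem edge_multiset_perm (B : Fin 4 → E3) (σ : Equiv.Perm (Fin 4)) :
    ({rootProduct (B ∘ σ) 2 3, rootProduct (B ∘ σ) 1 3, rootProduct (B ∘ σ) 1 2,
      rootProduct (B ∘ σ) 0 1, rootProduct (B ∘ σ) 0 2, rootProduct (B ∘ σ) 0 3} : Multiset ℝ) =
    {rootProduct B 2 3, rootProduct B 1 3, rootProduct B 1 2,
      rootProduct B 0 1, rootProduct B 0 2, rootProduct B 0 3} := by
  have key : ∀ σ : Equiv.Perm (Fin 4), ({s(σ 2, σ 3), s(σ 1, σ 3), s(σ 1, σ 2), s(σ 0, σ 1),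
      s(σ 0, σ 2), s(σ 0, σ 3)} : Multiset (Sym2 (Fin 4))) =
      {s(2, 3), s(1, 3), s(1, 2), s(0, 1), s(0, 2), s(0, 3)} := by decide
  exact congrArg (Multiset.map (Sym2.lift ⟨rootProduct B, rootProduct_comm B⟩)) (key σ)

/-! ### Zero patterns, existence of root data, and normal forms -/

section Support

/-- The entries of a symmetric matrix of booleans of order four with zero diagonal. -/
def symmBool (z01 z02 z03 z12 z13 z23 : Bool) : Fin 4 → Fin 4 → Bool :=
  ![![false, z01, z02, z03], ![z01, false, z12, z13], ![z02, z12, false, z23],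
    ![z03, z13, z23, false]]

set_option synthInstance.maxHeartbeats 400000 in
set_option synthInstance.maxSize 1000 in
/-- The connected graphs with four vertices up to isomorphism, given by their missing edges. -/
theorem exists_perm_symmBool : ∀ z01 z02 z03 z12 z13 z23 : Bool,
    ¬ (z01 ∧ z12 ∧ z13) → ¬ (z02 ∧ z12 ∧ z23) → ¬ (z03 ∧ z13 ∧ z23) → ¬ (z01 ∧ z02 ∧ z03) →
    ¬ (z01 ∧ z02 ∧ z13 ∧ z23) → ¬ (z01 ∧ z03 ∧ z12 ∧ z23) → ¬ (z02 ∧ z03 ∧ z12 ∧ z13) →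
    ∃ σ : Equiv.Perm (Fin 4),
      (symmBool z01 z02 z03 z12 z13 z23 (σ 2) (σ 3), symmBool z01 z02 z03 z12 z13 z23 (σ 1) (σ 3),
        symmBool z01 z02 z03 z12 z13 z23 (σ 1) (σ 2), symmBool z01 z02 z03 z12 z13 z23 (σ 0) (σ 1),
        symmBool z01 z02 z03 z12 z13 z23 (σ 0) (σ 2),
        symmBool z01 z02 z03 z12 z13 z23 (σ 0) (σ 3)) ∈
      [(false, false, false, false, false, false), (true, false, false, false, false, false),
        (true, false, false, true, false, false), (true, true, false, false, false, false),
        (true, true, true, false, false, false), (true, true, false, false, true, false)] := by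
  decide +kernel

variable {Λ : Submodule ℤ E3} {B : Fin 4 → E3}

theorem IsObtuseSuperbase.sum_conorm_pos (h : IsObtuseSuperbase Λ B) {n : Fin 3 → ℤ}
    (hn : n ≠ 0) :
    0 < conorm B 0 1 * (n 0 : ℝ) ^ 2 + conorm B 0 2 * (n 1 : ℝ) ^ 2 +
      conorm B 0 3 * (n 2 : ℝ) ^ 2 + conorm B 1 2 * (n 0 - n 1 : ℝ) ^ 2 +
      conorm B 1 3 * (n 0 - n 2 : ℝ) ^ 2 + conorm B 2 3 * (n 1 - n 2 : ℝ) ^ 2 := by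
  have hx := h.norm_sq_eq (∑ i, n i • h.basis i)
  simp only [h.basis.repr_sum_self] at hx
  rw [← hx]
  have h0 : ∑ i, n i • h.basis i ≠ 0 := fun h0 => hn <| by
    ext i
    rw [← h.basis.repr_sum_self n, h0, map_zero]
    rfl
  have : 0 < ‖((∑ i, n i • h.basis i : Λ) : E3)‖ := norm_pos_iff.2 (by exact_mod_cast h0)
  positivity

/-- The graph of non-zero root products is connected: if all conorms across a cut vanished, the sum
of the vectors on one side would be a non-zero lattice vector of norm zero. The seven coordinate
vectors tested are the seven cuts of four indices. -/
theorem IsObtuseSuperbase.exists_zero_pattern (h : IsObtuseSuperbase Λ B) :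
    ∃ σ : Equiv.Perm (Fin 4),
      (decide (rootProduct (B ∘ σ) 2 3 = 0), decide (rootProduct (B ∘ σ) 1 3 = 0),
        decide (rootProduct (B ∘ σ) 1 2 = 0), decide (rootProduct (B ∘ σ) 0 1 = 0),
        decide (rootProduct (B ∘ σ) 0 2 = 0), decide (rootProduct (B ∘ σ) 0 3 = 0)) ∈
      [(false, false, false, false, false, false), (true, false, false, false, false, false),
        (true, false, false, true, false, false), (true, true, false, false, false, false),
        (true, true, true, false, false, false), (true, true, false, false, true, false)] := by
  have hz (i j : Fin 4) (hij : i ≠ j) : rootProduct B i j = 0 ↔ conorm B i j = 0 := by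
    rw [← h.rootProduct_sq hij, sq_eq_zero_iff]
  have s1 := h.sum_conorm_pos (n := ![1, 0, 0]) (by decide)
  have s2 := h.sum_conorm_pos (n := ![0, 1, 0]) (by decide)
  have s3 := h.sum_conorm_pos (n := ![0, 0, 1]) (by decide)
  have s4 := h.sum_conorm_pos (n := ![1, 1, 1]) (by decide)
  have s5 := h.sum_conorm_pos (n := ![1, 1, 0]) (by decide)
  have s6 := h.sum_conorm_pos (n := ![1, 0, 1]) (by decide)
  have s7 := h.sum_conorm_pos (n := ![0, 1, 1]) (by decide)
  simp at s1 s2 s3 s4 s5 s6 s7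
  let z (i j : Fin 4) : Bool := decide (rootProduct B i j = 0)
  obtain ⟨σ, hσ⟩ := exists_perm_symmBool (z 0 1) (z 0 2) (z 0 3) (z 1 2) (z 1 3) (z 2 3)
    (by simp only [z, decide_eq_true_eq, hz _ _ (by decide : (0 : Fin 4) ≠ 1),
          hz _ _ (by decide : (1 : Fin 4) ≠ 2), hz _ _ (by decide : (1 : Fin 4) ≠ 3)]
        rintro ⟨h1, h2, h3⟩; linarith)
    (by simp only [z, decide_eq_true_eq, hz _ _ (by decide : (0 : Fin 4) ≠ 2),
          hz _ _ (by decide : (1 : Fin 4) ≠ 2), hz _ _ (by decide : (2 : Fin 4) ≠ 3)]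
        rintro ⟨h1, h2, h3⟩; linarith)
    (by simp only [z, decide_eq_true_eq, hz _ _ (by decide : (0 : Fin 4) ≠ 3),
          hz _ _ (by decide : (1 : Fin 4) ≠ 3), hz _ _ (by decide : (2 : Fin 4) ≠ 3)]
        rintro ⟨h1, h2, h3⟩; linarith)
    (by simp only [z, decide_eq_true_eq, hz _ _ (by decide : (0 : Fin 4) ≠ 1),
          hz _ _ (by decide : (0 : Fin 4) ≠ 2), hz _ _ (by decide : (0 : Fin 4) ≠ 3)]
        rintro ⟨h1, h2, h3⟩; linarith)
    (by simp only [z, decide_eq_true_eq, hz _ _ (by decide : (0 : Fin 4) ≠ 1),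
          hz _ _ (by decide : (0 : Fin 4) ≠ 2), hz _ _ (by decide : (1 : Fin 4) ≠ 3),
          hz _ _ (by decide : (2 : Fin 4) ≠ 3)]
        rintro ⟨h1, h2, h3, h4⟩; linarith)
    (by simp only [z, decide_eq_true_eq, hz _ _ (by decide : (0 : Fin 4) ≠ 1),
          hz _ _ (by decide : (0 : Fin 4) ≠ 3), hz _ _ (by decide : (1 : Fin 4) ≠ 2),
          hz _ _ (by decide : (2 : Fin 4) ≠ 3)]
        rintro ⟨h1, h2, h3, h4⟩; linarith)
    (by simp only [z, decide_eq_true_eq, hz _ _ (by decide : (0 : Fin 4) ≠ 2),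
          hz _ _ (by decide : (0 : Fin 4) ≠ 3), hz _ _ (by decide : (1 : Fin 4) ≠ 2),
          hz _ _ (by decide : (1 : Fin 4) ≠ 3)]
        rintro ⟨h1, h2, h3, h4⟩; linarith)
  refine ⟨σ, ?_⟩
  have hs (i j : Fin 4) (hij : i ≠ j) : symmBool (z 0 1) (z 0 2) (z 0 3) (z 1 2) (z 1 3) (z 2 3)
      i j = z i j := by
    have hc (i j : Fin 4) : z i j = z j i := by simp only [z, rootProduct_comm]
    fin_cases i <;> fin_cases j <;> first | exact absurd rfl hij | rfl | exact hc _ _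
  rw [hs _ _ (σ.injective.ne (by decide)), hs _ _ (σ.injective.ne (by decide)),
    hs _ _ (σ.injective.ne (by decide)), hs _ _ (σ.injective.ne (by decide)),
    hs _ _ (σ.injective.ne (by decide)), hs _ _ (σ.injective.ne (by decide))] at hσ
  exact hσ

theorem rotate_zeros (x y z : ℝ) :
    ({0, 0, x, y, 0, z} : Multiset ℝ) = {0, 0, 0, y, x, z} := by
  simp only [Multiset.insert_eq_cons]
  rw [Multiset.cons_swap y 0, Multiset.cons_swap x 0, Multiset.cons_swap x y]

/-- Of the six connected graphs the last two, the star and the path, both give type `V5`. -/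
theorem IsObtuseSuperbase.exists_isRootData (h : IsObtuseSuperbase Λ B) :
    ∃ ρ, IsRootData B ρ := by
  obtain ⟨σ, hσ⟩ := h.exists_zero_pattern
  have hp {i j : Fin 4} (h0 : rootProduct (B ∘ σ) i j ≠ 0) : 0 < rootProduct (B ∘ σ) i j :=
    lt_of_le_of_ne (rootProduct_nonneg _ _ _) (Ne.symm h0)
  simp only [List.mem_cons, List.not_mem_nil, Prod.mk.injEq, decide_eq_true_eq,
    decide_eq_false_iff_not, or_false] at hσ
  rcases hσ with ⟨h1, h2, h3, h4, h5, h6⟩ | ⟨h1, h2, h3, h4, h5, h6⟩ | ⟨h1, h2, h3, h4, h5, h6⟩ |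
    ⟨h1, h2, h3, h4, h5, h6⟩ | ⟨h1, h2, h3, h4, h5, h6⟩ | ⟨h1, h2, h3, h4, h5, h6⟩
  · obtain ⟨τ, -, hτ⟩ := Finset.exists_min_image Finset.univ
      (fun τ : Equiv.Perm (Fin 4) => rowLex (rootForm (B ∘ τ))) Finset.univ_nonempty
    refine ⟨.V1 (rootForm (B ∘ τ)), ?_, ⟨τ, rfl⟩, fun τ' => hτ τ' (Finset.mem_univ _)⟩
    have hall : ∀ i j, i ≠ j → rootProduct (B ∘ σ) i j ≠ 0 := by
      intro i j hij
      fin_cases i <;> fin_cases j <;>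
        first | exact absurd rfl hij | assumption | (rw [rootProduct_comm]; assumption)
    intro i j hij
    have := hall (σ.symm i) (σ.symm j) (σ.symm.injective.ne hij)
    simpa [rootProduct_comp] using this
  · obtain ⟨a, b, c, d, he, h7, h8, h9, h10⟩ := exists_sorted_square (rootProduct (B ∘ σ) 1 3)
      (rootProduct (B ∘ σ) 0 3) (rootProduct (B ∘ σ) 1 2) (rootProduct (B ∘ σ) 0 2)
    refine ⟨.V2 _ a b c d, ⟨σ, h1, rfl, he⟩, hp h4, ?_, h7, h8, h9, h10⟩
    have ha : s(a, d) ∈ s(s(rootProduct (B ∘ σ) 1 3, rootProduct (B ∘ σ) 0 3),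
        s(rootProduct (B ∘ σ) 1 2, rootProduct (B ∘ σ) 0 2)) := by rw [he]; simp
    rcases Sym2.mem_iff.1 ha with e | e <;> rcases Sym2.eq_iff.1 e with ⟨rfl, -⟩ | ⟨rfl, -⟩
    exacts [hp h2, hp h6, hp h3, hp h5]
  · obtain ⟨a, b, c, d, he, h7, h8, h9⟩ := exists_sorted_quadruple (rootProduct (B ∘ σ) 1 3)
      (rootProduct (B ∘ σ) 1 2) (rootProduct (B ∘ σ) 0 2) (rootProduct (B ∘ σ) 0 3)
    refine ⟨.V3 a b c d, ⟨σ, h1, h4, he⟩, ?_, h7, h8, h9⟩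
    have ha : a ∈ ({rootProduct (B ∘ σ) 1 3, rootProduct (B ∘ σ) 1 2, rootProduct (B ∘ σ) 0 2,
      rootProduct (B ∘ σ) 0 3} : Multiset ℝ) := by rw [he]; simp
    simp only [Multiset.insert_eq_cons, Multiset.mem_cons, Multiset.mem_singleton] at ha
    rcases ha with rfl | rfl | rfl | rfl
    exacts [hp h2, hp h3, hp h5, hp h6]
  · obtain ⟨a, b, c, he, h7, h8⟩ := exists_sorted_triple (rootProduct (B ∘ σ) 1 2)
      (rootProduct (B ∘ σ) 0 1) (rootProduct (B ∘ σ) 0 2)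
    refine ⟨.V4 a b c _, ⟨σ, h1, h2, he, rfl⟩, hp h6, ?_, h7, h8⟩
    have ha : a ∈ ({rootProduct (B ∘ σ) 1 2, rootProduct (B ∘ σ) 0 1,
      rootProduct (B ∘ σ) 0 2} : Multiset ℝ) := by rw [he]; simp
    simp only [Multiset.insert_eq_cons, Multiset.mem_cons, Multiset.mem_singleton] at ha
    rcases ha with rfl | rfl | rfl
    exacts [hp h3, hp h4, hp h5]
  · obtain ⟨a, b, c, he, h7, h8⟩ := exists_sorted_triple (rootProduct (B ∘ σ) 0 1)
      (rootProduct (B ∘ σ) 0 2) (rootProduct (B ∘ σ) 0 3)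
    refine ⟨.V5 a b c, ?_, ?_, h7, h8⟩
    · rw [← edge_multiset_perm B σ, h1, h2, h3]
      simp only [Multiset.insert_eq_cons] at he ⊢
      rw [he]
    have ha : a ∈ ({rootProduct (B ∘ σ) 0 1, rootProduct (B ∘ σ) 0 2,
      rootProduct (B ∘ σ) 0 3} : Multiset ℝ) := by rw [he]; simp
    simp only [Multiset.insert_eq_cons, Multiset.mem_cons, Multiset.mem_singleton] at ha
    rcases ha with rfl | rfl | rfl
    exacts [hp h4, hp h5, hp h6]
  · obtain ⟨a, b, c, he, h7, h8⟩ := exists_sorted_triple (rootProduct (B ∘ σ) 0 1)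
      (rootProduct (B ∘ σ) 1 2) (rootProduct (B ∘ σ) 0 3)
    refine ⟨.V5 a b c, ?_, ?_, h7, h8⟩
    · rw [← edge_multiset_perm B σ, h1, h2, h5, rotate_zeros]
      simp only [Multiset.insert_eq_cons] at he ⊢
      rw [he]
    have ha : a ∈ ({rootProduct (B ∘ σ) 0 1, rootProduct (B ∘ σ) 1 2,
      rootProduct (B ∘ σ) 0 3} : Multiset ℝ) := by rw [he]; simp
    simp only [Multiset.insert_eq_cons, Multiset.mem_cons, Multiset.mem_singleton] at ha
    rcases ha with rfl | rfl | rfl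
    exacts [hp h4, hp h3, hp h6]

theorem IsRootData.isOrdered {ρ : RootInvariant} (hd : IsRootData B ρ) : ρ.IsOrdered := by
  cases ρ with
  | V1 M =>
    obtain ⟨h0, ⟨σ, rfl⟩, -⟩ := hd
    have hp (i j : Fin 4) (hij : i ≠ j) : 0 < rootProduct (B ∘ σ) i j :=
      lt_of_le_of_ne (rootProduct_nonneg _ _ _) (Ne.symm (h0 _ _ (σ.injective.ne hij)))
    intro i j
    fin_cases i <;> fin_cases j <;> exact hp _ _ (by decide)
  | V2 => exact hd.2
  | V3 => exact hd.2
  | V4 => exact hd.2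
  | V5 => exact hd.2

/-- Reorderings together with `twist` realise every rearrangement permitted by the type: the
symmetries of the square for `V2`, all permutations of the four entries for `V3`, of the three for
`V4` and `V5`. -/
theorem IsRootData.hasNormalForm [DiscreteTopology Λ] [IsZLattice ℝ Λ]
    (h : IsObtuseSuperbase Λ B) {ρ : RootInvariant} (hd : IsRootData B ρ) :
    HasNormalForm Λ ρ := by
  cases ρ with
  | V1 M =>
    obtain ⟨-, ⟨σ, rfl⟩, -⟩ := hd
    exact ⟨B ∘ σ, h.comp_perm σ, rfl, rfl, rfl, rfl, rfl, rfl⟩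
  | V2 r01 r13 r12 r02 r03 =>
    obtain ⟨⟨σ, h0, rfl, he⟩, -⟩ := hd
    have hr : HasRootProducts Λ 0 _ _ _ _ _ := ⟨B ∘ σ, h.comp_perm σ, h0, rfl, rfl, rfl, rfl, rfl⟩
    generalize rootProduct (B ∘ σ) 1 3 = x13 at *
    generalize rootProduct (B ∘ σ) 1 2 = x12 at *
    generalize rootProduct (B ∘ σ) 0 2 = x02 at *
    generalize rootProduct (B ∘ σ) 0 3 = x03 at *
    change HasRootProducts Λ 0 _ _ _ _ _
    rcases Sym2.eq_iff.1 he with ⟨e, e'⟩ | ⟨e, e'⟩ <;>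
    rcases Sym2.eq_iff.1 e with ⟨rfl, rfl⟩ | ⟨rfl, rfl⟩ <;>
    rcases Sym2.eq_iff.1 e' with ⟨rfl, rfl⟩ | ⟨rfl, rfl⟩
    · exact hr
    · exact hr.twist
    · exact hr.swap01.twist
    · exact hr.swap01
    · exact hr.swap23
    · exact hr.twist.swap23
    · exact hr.swap01.twist.swap23
    · exact hr.swap01.swap23
  | V3 a b c d =>
    obtain ⟨⟨σ, h0, h0', he⟩, -⟩ := hd
    have hr : HasRootProducts Λ 0 _ _ 0 _ _ := ⟨B ∘ σ, h.comp_perm σ, h0, rfl, rfl, h0', rfl, rfl⟩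
    exact quadruple_rec (P := fun a b c d => HasRootProducts Λ 0 a b 0 c d)
      (fun _ _ _ _ h => h.rotate.twist.rotate.swap23)
      (fun _ _ _ _ h => h.twist) (fun _ _ _ _ h => h.rotate.twist.rotate) he hr
  | V4 a b c r03 =>
    obtain ⟨⟨σ, h0, h0', he, rfl⟩, -⟩ := hd
    have hr : HasRootProducts Λ 0 0 _ _ _ _ := ⟨B ∘ σ, h.comp_perm σ, h0, h0', rfl, rfl, rfl, rfl⟩
    exact triple_rec (P := fun a b c => HasRootProducts Λ 0 0 a b c _)
      (fun _ _ _ h => h.twist.swap12.twist) (fun _ _ _ h => h.swap12) he hr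
  | V5 a b c =>
    obtain ⟨he, ha, hab, hbc⟩ := hd
    have hb := ha.trans_le hab
    have hc := hb.trans_le hbc
    obtain ⟨σ, hσ⟩ := h.exists_zero_pattern
    simp only [List.mem_cons, List.not_mem_nil, Prod.mk.injEq, decide_eq_true_eq,
      decide_eq_false_iff_not, or_false] at hσ
    rw [← edge_multiset_perm B σ] at he
    -- Counting zeros leaves only the two patterns with three of them.
    have hcount := congrArg (Multiset.count 0) he
    simp only [Multiset.insert_eq_cons, Multiset.count_cons, Multiset.count_singleton,
      ha.ne, hb.ne, hc.ne, if_true, if_false] at hcount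
    have perm : ∀ x y z : ℝ, ({x, y, z} : Multiset ℝ) = {a, b, c} → HasRootProducts Λ 0 0 0 x y z →
        HasRootProducts Λ 0 0 0 a b c := fun x y z =>
      triple_rec (P := fun a b c => HasRootProducts Λ 0 0 0 a b c)
        (fun _ _ _ h => h.swap12) (fun _ _ _ h => h.swap23)
    have hr : HasRootProducts Λ _ _ _ _ _ _ := ⟨B ∘ σ, h.comp_perm σ, rfl, rfl, rfl, rfl, rfl, rfl⟩
    rcases hσ with ⟨h1, h2, h3, h4, h5, h6⟩ | ⟨h1, h2, h3, h4, h5, h6⟩ |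
      ⟨h1, h2, h3, h4, h5, h6⟩ | ⟨h1, h2, h3, h4, h5, h6⟩ | ⟨h1, h2, h3, h4, h5, h6⟩ |
      ⟨h1, h2, h3, h4, h5, h6⟩
    · simp [Ne.symm h1, Ne.symm h2, Ne.symm h3, Ne.symm h4, Ne.symm h5, Ne.symm h6] at hcount
    · simp [h1, Ne.symm h2, Ne.symm h3, Ne.symm h4, Ne.symm h5, Ne.symm h6] at hcount
    · simp [h1, Ne.symm h2, Ne.symm h3, h4, Ne.symm h5, Ne.symm h6] at hcount
    · simp [h1, h2, Ne.symm h3, Ne.symm h4, Ne.symm h5, Ne.symm h6] at hcount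
    · rw [h1, h2, h3] at he hr
      exact perm _ _ _ (by simpa [Multiset.insert_eq_cons] using he) hr
    -- Here the non-zero root products form a path; `twist` turns it into the star of the normal
    -- form.
    · rw [h1, h2, h5] at he hr
      rw [rotate_zeros] at he
      exact perm _ _ _ (by simpa [Multiset.insert_eq_cons] using he) hr.twist

end Support

/-! ## Uniqueness of root invariants -/

/-- The points of the Fano plane where the root products of a normal form vanish. -/
def RootInvariant.zeroPoints : RootInvariant → Finset (Fin 3 → ZMod 2)
  | .V1 _ => {1}
  | .V2 _ _ _ _ _ => {1, edge 2 3}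
  | .V3 _ _ _ _ => {1, edge 2 3, edge 0 1}
  | .V4 _ _ _ _ => {1, edge 2 3, edge 1 3}
  | .V5 _ _ _ => {1, edge 2 3, edge 1 3, edge 1 2}

theorem zero_notMem_zeroPoints (ρ : RootInvariant) : 0 ∉ ρ.zeroPoints := by
  cases ρ <;> simp only [RootInvariant.zeroPoints] <;> decide

theorem IsNormal.fanoValue_eq_zero_iff {B : Fin 4 → E3} {ρ : RootInvariant} (hN : IsNormal B ρ)
    (ho : ρ.IsOrdered) {χ : Fin 3 → ZMod 2} (hχ : χ ≠ 0) :
    fanoValue (rootProduct B) χ = 0 ↔ χ ∈ ρ.zeroPoints := by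
  cases ρ with
  | V1 M =>
    obtain ⟨h1, h2, h3, h4, h5, h6⟩ := hN
    simp only [RootInvariant.zeroPoints]
    rcases eq_edge_or χ with rfl | rfl | rfl | rfl | rfl | rfl | rfl | rfl
    · exact absurd rfl hχ
    · exact iff_of_true (fanoValue_one _) (by decide)
    · exact iff_of_false (by rw [fanoValue_edge01, h4]; exact (ho _ _).ne') (by decide)
    · exact iff_of_false (by rw [fanoValue_edge02, h5]; exact (ho _ _).ne') (by decide)
    · exact iff_of_false (by rw [fanoValue_edge03, h6]; exact (ho _ _).ne') (by decide)
    · exact iff_of_false (by rw [fanoValue_edge12, h3]; exact (ho _ _).ne') (by decide)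
    · exact iff_of_false (by rw [fanoValue_edge13, h2]; exact (ho _ _).ne') (by decide)
    · exact iff_of_false (by rw [fanoValue_edge23, h1]; exact (ho _ _).ne') (by decide)
  | V2 r01 r13 r12 r02 r03 =>
    obtain ⟨h1, h2, h3, h4, h5, h6⟩ := hN
    obtain ⟨o1, o2, o3, o4, o5, -⟩ := ho
    simp only [RootInvariant.zeroPoints]
    rcases eq_edge_or χ with rfl | rfl | rfl | rfl | rfl | rfl | rfl | rfl
    · exact absurd rfl hχ
    · exact iff_of_true (fanoValue_one _) (by decide)
    · exact iff_of_false (by rw [fanoValue_edge01, h4]; linarith) (by decide)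
    · exact iff_of_false (by rw [fanoValue_edge02, h5]; linarith) (by decide)
    · exact iff_of_false (by rw [fanoValue_edge03, h6]; linarith) (by decide)
    · exact iff_of_false (by rw [fanoValue_edge12, h3]; linarith) (by decide)
    · exact iff_of_false (by rw [fanoValue_edge13, h2]; linarith) (by decide)
    · exact iff_of_true (by rw [fanoValue_edge23, h1]) (by decide)
  | V3 a b c d =>
    obtain ⟨h1, h2, h3, h4, h5, h6⟩ := hN
    obtain ⟨o1, o2, o3, o4⟩ := ho
    simp only [RootInvariant.zeroPoints]
    rcases eq_edge_or χ with rfl | rfl | rfl | rfl | rfl | rfl | rfl | rfl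
    · exact absurd rfl hχ
    · exact iff_of_true (fanoValue_one _) (by decide)
    · exact iff_of_true (by rw [fanoValue_edge01, h4]) (by decide)
    · exact iff_of_false (by rw [fanoValue_edge02, h5]; linarith) (by decide)
    · exact iff_of_false (by rw [fanoValue_edge03, h6]; linarith) (by decide)
    · exact iff_of_false (by rw [fanoValue_edge12, h3]; linarith) (by decide)
    · exact iff_of_false (by rw [fanoValue_edge13, h2]; linarith) (by decide)
    · exact iff_of_true (by rw [fanoValue_edge23, h1]) (by decide)
  | V4 a b c r03 =>
    obtain ⟨h1, h2, h3, h4, h5, h6⟩ := hN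
    obtain ⟨o1, o2, o3, o4⟩ := ho
    simp only [RootInvariant.zeroPoints]
    rcases eq_edge_or χ with rfl | rfl | rfl | rfl | rfl | rfl | rfl | rfl
    · exact absurd rfl hχ
    · exact iff_of_true (fanoValue_one _) (by decide)
    · exact iff_of_false (by rw [fanoValue_edge01, h4]; linarith) (by decide)
    · exact iff_of_false (by rw [fanoValue_edge02, h5]; linarith) (by decide)
    · exact iff_of_false (by rw [fanoValue_edge03, h6]; linarith) (by decide)
    · exact iff_of_false (by rw [fanoValue_edge12, h3]; linarith) (by decide)
    · exact iff_of_true (by rw [fanoValue_edge13, h2]) (by decide)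
    · exact iff_of_true (by rw [fanoValue_edge23, h1]) (by decide)
  | V5 a b c =>
    obtain ⟨h1, h2, h3, h4, h5, h6⟩ := hN
    obtain ⟨o1, o2, o3⟩ := ho
    simp only [RootInvariant.zeroPoints]
    rcases eq_edge_or χ with rfl | rfl | rfl | rfl | rfl | rfl | rfl | rfl
    · exact absurd rfl hχ
    · exact iff_of_true (fanoValue_one _) (by decide)
    · exact iff_of_false (by rw [fanoValue_edge01, h4]; linarith) (by decide)
    · exact iff_of_false (by rw [fanoValue_edge02, h5]; linarith) (by decide)
    · exact iff_of_false (by rw [fanoValue_edge03, h6]; linarith) (by decide)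
    · exact iff_of_true (by rw [fanoValue_edge12, h3]) (by decide)
    · exact iff_of_true (by rw [fanoValue_edge13, h2]) (by decide)
    · exact iff_of_true (by rw [fanoValue_edge23, h1]) (by decide)

/-! ### Stabilisers of zero sets in the collineation group -/

section Collineation

variable {φ : (Fin 3 → ZMod 2) →+ (Fin 3 → ZMod 2)}

/-- The characters `edge 0 1`, `edge 0 2`, `edge 0 3` form a basis, so statements about `φ` reduce
to a finite check over three independent vectors. -/
theorem collineation_edges (φ : (Fin 3 → ZMod 2) →+ (Fin 3 → ZMod 2)) :
    φ 1 = φ (edge 0 1) + φ (edge 0 2) + φ (edge 0 3) ∧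
    φ (edge 1 2) = φ (edge 0 1) + φ (edge 0 2) ∧
    φ (edge 1 3) = φ (edge 0 1) + φ (edge 0 3) ∧
    φ (edge 2 3) = φ (edge 0 2) + φ (edge 0 3) := by
  simp only [← map_add]
  refine ⟨?_, ?_, ?_, ?_⟩ <;> exact congrArg φ (by decide)

theorem collineation_ne_zero (hφ : Function.Injective φ) :
    φ (edge 0 1) ≠ 0 ∧ φ (edge 0 2) ≠ 0 ∧ φ (edge 0 3) ≠ 0 ∧
      φ (edge 0 1) ≠ φ (edge 0 2) ∧ φ (edge 0 1) ≠ φ (edge 0 3) ∧ φ (edge 0 2) ≠ φ (edge 0 3) ∧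
      φ (edge 0 1) + φ (edge 0 2) + φ (edge 0 3) ≠ 0 := by
  rw [← map_add, ← map_add]
  refine ⟨?_, ?_, ?_, hφ.ne (by decide), hφ.ne (by decide), hφ.ne (by decide), ?_⟩ <;>
  · rw [Ne, map_eq_zero_iff φ hφ]; decide

/-- The stabiliser of a point of the Fano plane has order 24 and is the symmetric group of the four
indices. -/
theorem collineation_fixing_point (hφ : Function.Injective φ) (h1 : φ 1 = 1) :
    ∃ σ : Equiv.Perm (Fin 4), ∀ i j, i ≠ j → φ (edge i j) = edge (σ i) (σ j) := by
  have key : ∀ a b c : Fin 3 → ZMod 2, a + b + c = 1 → a ≠ 0 ∧ b ≠ 0 ∧ c ≠ 0 ∧ a ≠ b ∧ a ≠ c ∧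
      b ≠ c ∧ a + b + c ≠ 0 → ∃ σ : Equiv.Perm (Fin 4), a = edge (σ 0) (σ 1) ∧
        b = edge (σ 0) (σ 2) ∧ c = edge (σ 0) (σ 3) := by decide +kernel
  obtain ⟨e1, e2, e3, e4⟩ := collineation_edges φ
  obtain ⟨σ, s1, s2, s3⟩ := key _ _ _ (e1 ▸ h1) (collineation_ne_zero hφ)
  have hadd : ∀ i j k : Fin 4, edge i j + edge i k = edge j k := by decide
  have hcomm : ∀ i j : Fin 4, edge i j = edge j i := by decide
  rw [s1, s2, hadd] at e2
  rw [s1, s3, hadd] at e3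
  rw [s2, s3, hadd] at e4
  refine ⟨σ, fun i j hij => ?_⟩
  fin_cases i <;> fin_cases j <;>
    first | exact absurd rfl hij | assumption | (rw [hcomm, hcomm (σ _)]; assumption)

-- The point `edge 0 1` is the third one on the line through the two given points, hence fixed. The
-- other two lines through it are the diagonals of the square, and they are permuted.
set_option synthInstance.maxHeartbeats 400000 in
set_option synthInstance.maxSize 1000 in
theorem collineation_fixing_two (hφ : Function.Injective φ)
    (h1 : φ 1 ∈ ({1, edge 2 3} : Finset (Fin 3 → ZMod 2)))
    (h2 : φ (edge 2 3) ∈ ({1, edge 2 3} : Finset (Fin 3 → ZMod 2))) :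
    φ (edge 0 1) = edge 0 1 ∧
    s(s(φ (edge 1 3), φ (edge 0 3)), s(φ (edge 1 2), φ (edge 0 2))) =
      s(s(edge 1 3, edge 0 3), s(edge 1 2, edge 0 2)) := by
  have key : ∀ a b c : Fin 3 → ZMod 2, a + b + c ∈ ({1, edge 2 3} : Finset (Fin 3 → ZMod 2)) →
      b + c ∈ ({1, edge 2 3} : Finset (Fin 3 → ZMod 2)) →
      a ≠ 0 ∧ b ≠ 0 ∧ c ≠ 0 ∧ a ≠ b ∧ a ≠ c ∧ b ≠ c ∧ a + b + c ≠ 0 →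
      a = edge 0 1 ∧ s(s(a + c, c), s(a + b, b)) =
        s(s(edge 1 3, edge 0 3), s(edge 1 2, edge 0 2)) := by decide +kernel
  obtain ⟨e1, e2, e3, e4⟩ := collineation_edges φ
  rw [e1] at h1
  rw [e4] at h2
  rw [e2, e3]
  exact key _ _ _ h1 h2 (collineation_ne_zero hφ)

-- The three points form a line, so two images in it determine the third, and the four points off
-- the line are permuted.
set_option synthInstance.maxHeartbeats 400000 in
set_option synthInstance.maxSize 1000 in
theorem collineation_fixing_line (hφ : Function.Injective φ)
    (h1 : φ 1 ∈ ({1, edge 2 3, edge 0 1} : Finset (Fin 3 → ZMod 2)))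
    (h2 : φ (edge 2 3) ∈ ({1, edge 2 3, edge 0 1} : Finset (Fin 3 → ZMod 2))) :
    ({φ (edge 1 3), φ (edge 1 2), φ (edge 0 2), φ (edge 0 3)} : Multiset (Fin 3 → ZMod 2)) =
      {edge 1 3, edge 1 2, edge 0 2, edge 0 3} := by
  have key : ∀ a b c : Fin 3 → ZMod 2,
      a + b + c ∈ ({1, edge 2 3, edge 0 1} : Finset (Fin 3 → ZMod 2)) →
      b + c ∈ ({1, edge 2 3, edge 0 1} : Finset (Fin 3 → ZMod 2)) →
      a ≠ 0 ∧ b ≠ 0 ∧ c ≠ 0 ∧ a ≠ b ∧ a ≠ c ∧ b ≠ c ∧ a + b + c ≠ 0 →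
      ({a + c, a + b, b, c} : Multiset (Fin 3 → ZMod 2)) =
        {edge 1 3, edge 1 2, edge 0 2, edge 0 3} := by decide +kernel
  obtain ⟨e1, e2, e3, e4⟩ := collineation_edges φ
  rw [e1] at h1
  rw [e4] at h2
  rw [e2, e3]
  exact key _ _ _ h1 h2 (collineation_ne_zero hφ)

-- The three points form a triangle. The third points on its sides are permuted, and the one
-- remaining point of the plane is fixed.
set_option synthInstance.maxHeartbeats 400000 in
set_option synthInstance.maxSize 1000 in
theorem collineation_fixing_triangle (hφ : Function.Injective φ)
    (h1 : φ 1 ∈ ({1, edge 2 3, edge 1 3} : Finset (Fin 3 → ZMod 2)))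
    (h2 : φ (edge 2 3) ∈ ({1, edge 2 3, edge 1 3} : Finset (Fin 3 → ZMod 2)))
    (h3 : φ (edge 1 3) ∈ ({1, edge 2 3, edge 1 3} : Finset (Fin 3 → ZMod 2))) :
    ({φ (edge 1 2), φ (edge 0 1), φ (edge 0 2)} : Multiset (Fin 3 → ZMod 2)) =
      {edge 1 2, edge 0 1, edge 0 2} ∧ φ (edge 0 3) = edge 0 3 := by
  have key : ∀ a b c : Fin 3 → ZMod 2,
      a + b + c ∈ ({1, edge 2 3, edge 1 3} : Finset (Fin 3 → ZMod 2)) →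
      b + c ∈ ({1, edge 2 3, edge 1 3} : Finset (Fin 3 → ZMod 2)) →
      a + c ∈ ({1, edge 2 3, edge 1 3} : Finset (Fin 3 → ZMod 2)) →
      a ≠ 0 ∧ b ≠ 0 ∧ c ≠ 0 ∧ a ≠ b ∧ a ≠ c ∧ b ≠ c ∧ a + b + c ≠ 0 →
      ({a + b, a, b} : Multiset (Fin 3 → ZMod 2)) = {edge 1 2, edge 0 1, edge 0 2} ∧
        c = edge 0 3 := by decide +kernel
  obtain ⟨e1, e2, e3, e4⟩ := collineation_edges φ
  rw [e1] at h1
  rw [e4] at h2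
  rw [e3] at h3
  rw [e2]
  exact key _ _ _ h1 h2 h3 (collineation_ne_zero hφ)

theorem collineation_multiset (hφ : Function.Injective φ) :
    ({φ 1, φ (edge 2 3), φ (edge 1 3), φ (edge 1 2), φ (edge 0 1), φ (edge 0 2),
      φ (edge 0 3)} : Multiset (Fin 3 → ZMod 2)) =
    {1, edge 2 3, edge 1 3, edge 1 2, edge 0 1, edge 0 2, edge 0 3} := by
  have e : (Finset.univ.val : Multiset (Fin 3 → ZMod 2)) = 0 ::ₘ
      {1, edge 2 3, edge 1 3, edge 1 2, edge 0 1, edge 0 2, edge 0 3} := by decide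
  have hb : Function.Bijective φ := Finite.injective_iff_bijective.1 hφ
  have h : (Finset.univ.val : Multiset (Fin 3 → ZMod 2)).map φ = Finset.univ.val :=
    Multiset.map_univ_val_equiv (Equiv.ofBijective φ hb)
  rw [e, Multiset.map_cons, map_zero, Multiset.cons_inj_right] at h
  exact h

end Collineation

/-! ### Independence of the superbase -/

section Unique

variable {Λ : Submodule ℤ E3} {B B' : Fin 4 → E3}

theorem fanoValue_edge {f : Fin 4 → Fin 4 → ℝ} (hf : ∀ i j, f i j = f j i) {i j : Fin 4}
    (hij : i ≠ j) : fanoValue f (edge i j) = f i j := by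
  have hcomm : ∀ i j : Fin 4, edge i j = edge j i := by decide
  fin_cases i <;> fin_cases j <;> first
    | exact absurd rfl hij
    | exact fanoValue_edge01 f
    | exact fanoValue_edge02 f
    | exact fanoValue_edge03 f
    | exact fanoValue_edge12 f
    | exact fanoValue_edge13 f
    | exact fanoValue_edge23 f
    | exact (congrArg _ (hcomm _ _)).trans ((fanoValue_edge01 f).trans (hf _ _))
    | exact (congrArg _ (hcomm _ _)).trans ((fanoValue_edge02 f).trans (hf _ _))
    | exact (congrArg _ (hcomm _ _)).trans ((fanoValue_edge03 f).trans (hf _ _))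
    | exact (congrArg _ (hcomm _ _)).trans ((fanoValue_edge12 f).trans (hf _ _))
    | exact (congrArg _ (hcomm _ _)).trans ((fanoValue_edge13 f).trans (hf _ _))
    | exact (congrArg _ (hcomm _ _)).trans ((fanoValue_edge23 f).trans (hf _ _))

theorem rowLex_injective : Function.Injective rowLex := by
  intro M N h
  have h' := toLex.injective h
  ext i j
  fin_cases i <;> fin_cases j
  · exact congrFun h' 0
  · exact congrFun h' 1
  · exact congrFun h' 2
  · exact congrFun h' 3
  · exact congrFun h' 4
  · exact congrFun h' 5

/-- As no root product vanishes, `1` is the only zero on the Fano plane and the collineation fixes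
it. It is therefore a reordering, which makes every root form of `B'` a root form of `B`. -/
theorem rowLex_min_le (h : IsObtuseSuperbase Λ B) (h' : IsObtuseSuperbase Λ B')
    {M M' : Matrix (Fin 2) (Fin 3) ℝ} (hd : IsRootData B (.V1 M)) (hd' : IsRootData B' (.V1 M')) :
    rowLex M ≤ rowLex M' := by
  obtain ⟨φ, hφ, hv⟩ := h.exists_collineation h'
  obtain ⟨h0, -, hmin⟩ := hd
  obtain ⟨-, ⟨τ, rfl⟩, -⟩ := hd'
  have h1 : φ 1 = 1 := by
    have e : fanoValue (rootProduct B) (φ 1) = 0 := by rw [hv, fanoValue_one]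
    have hne : φ 1 ≠ 0 := by rw [Ne, map_eq_zero_iff φ hφ]; decide
    rcases eq_edge_or (φ 1) with h | h | h | h | h | h | h | h
    · exact absurd h hne
    · exact h
    all_goals
      rw [h, fanoValue_edge (rootProduct_comm B) (by decide)] at e
      exact absurd e (h0 _ _ (by decide))
  obtain ⟨σ, hσ⟩ := collineation_fixing_point hφ h1
  have hr (i j : Fin 4) (hij : i ≠ j) :
      rootProduct (B' ∘ τ) i j = rootProduct (B ∘ (σ * τ : Equiv.Perm (Fin 4))) i j := by
    have hτ := τ.injective.ne hij
    rw [rootProduct_comp, ← fanoValue_edge (rootProduct_comm B') hτ, ← hv, hσ _ _ hτ,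
      fanoValue_edge (rootProduct_comm B) (σ.injective.ne hτ)]
    rfl
  have : rootForm (B' ∘ τ) = rootForm (B ∘ (σ * τ : Equiv.Perm (Fin 4))) := by
    simp only [rootForm]
    rw [hr _ _ (by decide), hr _ _ (by decide), hr _ _ (by decide), hr _ _ (by decide),
      hr _ _ (by decide), hr _ _ (by decide)]
  rw [this]
  exact hmin _

/-- A collineation between the two normal forms carries one zero set onto the other. This fixes the
type, and then the stabiliser of the zero set together with the ordering conditions fixes the
entries. -/
theorem IsRootData.unique [DiscreteTopology Λ] [IsZLattice ℝ Λ]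
    (h : IsObtuseSuperbase Λ B) (h' : IsObtuseSuperbase Λ B') {ρ ρ' : RootInvariant}
    (hd : IsRootData B ρ) (hd' : IsRootData B' ρ') : ρ = ρ' := by
  obtain ⟨C, hC, hN⟩ := hd.hasNormalForm h
  obtain ⟨C', hC', hN'⟩ := hd'.hasNormalForm h'
  obtain ⟨φ, hφ, hv⟩ := hC.exists_collineation hC'
  have hne {χ : Fin 3 → ZMod 2} (hχ : χ ≠ 0) : φ χ ≠ 0 := by rwa [Ne, map_eq_zero_iff φ hφ]
  have hz {χ : Fin 3 → ZMod 2} (hχ : χ ≠ 0) : φ χ ∈ ρ.zeroPoints ↔ χ ∈ ρ'.zeroPoints := by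
    rw [← hN.fanoValue_eq_zero_iff hd.isOrdered (hne hχ),
      ← hN'.fanoValue_eq_zero_iff hd'.isOrdered hχ, hv]
  have hmap : ρ'.zeroPoints.map ⟨φ, hφ⟩ = ρ.zeroPoints := by
    ext χ
    simp only [Finset.mem_map, Function.Embedding.coeFn_mk]
    constructor
    · rintro ⟨η, hη, rfl⟩
      exact (hz fun h0 => zero_notMem_zeroPoints ρ' (h0 ▸ hη)).2 hη
    · intro hχ
      obtain ⟨η, rfl⟩ := (Finite.injective_iff_surjective.1 hφ) χ
      refine ⟨η, (hz ?_).1 hχ, rfl⟩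
      rintro rfl
      rw [map_zero] at hχ
      exact zero_notMem_zeroPoints ρ hχ
  -- The cardinalities 1, 2, 3, 3, 4 separate all types except `V3` and `V4`. Those differ in the
  -- sum of the zero points, which vanishes for a line but not for a triangle.
  have hcard : ρ'.zeroPoints.card = ρ.zeroPoints.card := by rw [← hmap, Finset.card_map]
  have hsum : φ (∑ χ ∈ ρ'.zeroPoints, χ) = ∑ χ ∈ ρ.zeroPoints, χ := by
    rw [← hmap, Finset.sum_map, map_sum]; rfl
  have ho := hd.isOrdered
  have ho' := hd'.isOrdered
  cases ρ with
  | V1 M =>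
    cases ρ' with
    | V1 M' =>
      exact congrArg _ (rowLex_injective (le_antisymm (rowLex_min_le h h' hd hd')
        (rowLex_min_le h' h hd' hd)))
    | _ => exact absurd hcard (by simp only [RootInvariant.zeroPoints]; decide)
  | V2 r01 r13 r12 r02 r03 =>
    cases ρ' with
    | V2 s01 s13 s12 s02 s03 =>
      obtain ⟨e, e'⟩ := collineation_fixing_two hφ
        ((hz (by decide)).2 (Finset.mem_insert_self _ _))
        ((hz (by decide)).2 (Finset.mem_insert_of_mem (Finset.mem_singleton_self _)))
      have e1 := congrArg (fanoValue (rootProduct C)) e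
      have e2 := congrArg (Sym2.map (Sym2.map (fanoValue (rootProduct C)))) e'
      obtain ⟨h1, h2, h3, h4, h5, h6⟩ := hN
      obtain ⟨k1, k2, k3, k4, k5, k6⟩ := hN'
      simp only [Sym2.map_mk, hv, fanoValue_edge01, fanoValue_edge02, fanoValue_edge03,
        fanoValue_edge12, fanoValue_edge13, h2, h3, h4, h5, h6, k2, k3, k4, k5, k6] at e1 e2
      obtain ⟨o1, o2, o3, o4, o5, o6⟩ := ho
      obtain ⟨p1, p2, p3, p4, p5, p6⟩ := ho'
      obtain ⟨rfl, rfl, rfl, rfl⟩ := square_unique e2 p3 p4 p5 p6 o3 o4 o5 o6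
      rw [e1]
    | _ => exact absurd hcard (by simp only [RootInvariant.zeroPoints]; decide)
  | V3 a b c d =>
    cases ρ' with
    | V3 a' b' c' d' =>
      have e := collineation_fixing_line hφ
        ((hz (by decide)).2 (Finset.mem_insert_self _ _))
        ((hz (by decide)).2 (Finset.mem_insert_of_mem (Finset.mem_insert_self _ _)))
      have e2 := congrArg (Multiset.map (fanoValue (rootProduct C))) e
      obtain ⟨h1, h2, h3, h4, h5, h6⟩ := hN
      obtain ⟨k1, k2, k3, k4, k5, k6⟩ := hN'
      simp only [Multiset.insert_eq_cons, Multiset.map_cons, Multiset.map_singleton, hv,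
        fanoValue_edge02, fanoValue_edge03,
        fanoValue_edge12, fanoValue_edge13, h2, h3, h5, h6, k2, k3, k5, k6] at e2
      obtain ⟨o1, o2, o3, o4⟩ := ho
      obtain ⟨p1, p2, p3, p4⟩ := ho'
      obtain ⟨rfl, rfl, rfl, rfl⟩ := quadruple_unique e2 p2 p3 p4 o2 o3 o4
      rfl
    | V4 =>
      have e := hne (χ := ∑ χ ∈ ({1, edge 2 3, edge 1 3} : Finset (Fin 3 → ZMod 2)), χ) (by decide)
      exact absurd hsum (by
        simp only [RootInvariant.zeroPoints]
        exact fun h => e (h.trans (by decide)))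
    | _ => exact absurd hcard (by simp only [RootInvariant.zeroPoints]; decide)
  | V4 a b c r03 =>
    cases ρ' with
    | V4 a' b' c' s03 =>
      obtain ⟨e, e'⟩ := collineation_fixing_triangle hφ
        ((hz (by decide)).2 (Finset.mem_insert_self _ _))
        ((hz (by decide)).2 (Finset.mem_insert_of_mem (Finset.mem_insert_self _ _)))
        ((hz (by decide)).2 (Finset.mem_insert_of_mem (Finset.mem_insert_of_mem
          (Finset.mem_singleton_self _))))
      have e1 := congrArg (fanoValue (rootProduct C)) e'
      have e2 := congrArg (Multiset.map (fanoValue (rootProduct C))) e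
      obtain ⟨h1, h2, h3, h4, h5, h6⟩ := hN
      obtain ⟨k1, k2, k3, k4, k5, k6⟩ := hN'
      simp only [Multiset.insert_eq_cons, Multiset.map_cons, Multiset.map_singleton, hv,
        fanoValue_edge02, fanoValue_edge03, fanoValue_edge01,
        fanoValue_edge12, h3, h4, h5, h6, k3, k4, k5, k6] at e1 e2
      obtain ⟨o1, o2, o3, o4⟩ := ho
      obtain ⟨p1, p2, p3, p4⟩ := ho'
      obtain ⟨rfl, rfl, rfl⟩ := triple_unique e2 p3 p4 o3 o4
      rw [e1]
    | V3 =>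
      have e : (∑ χ ∈ ({1, edge 2 3, edge 0 1} : Finset (Fin 3 → ZMod 2)), χ) = 0 := by decide
      simp only [RootInvariant.zeroPoints] at hsum
      rw [e, map_zero] at hsum
      exact absurd hsum (by decide)
    | _ => exact absurd hcard (by simp only [RootInvariant.zeroPoints]; decide)
  | V5 a b c =>
    cases ρ' with
    | V5 a' b' c' =>
      have e2 := congrArg (Multiset.map (fanoValue (rootProduct C))) (collineation_multiset hφ)
      obtain ⟨h1, h2, h3, h4, h5, h6⟩ := hN
      obtain ⟨k1, k2, k3, k4, k5, k6⟩ := hN'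
      simp only [Multiset.insert_eq_cons, Multiset.map_cons, Multiset.map_singleton, hv,
        fanoValue_one, fanoValue_edge02, fanoValue_edge03, fanoValue_edge01, fanoValue_edge12,
        fanoValue_edge13, fanoValue_edge23, h1, h2, h3, h4, h5, h6, k1, k2, k3, k4, k5, k6,
        Multiset.cons_inj_right] at e2
      obtain ⟨o1, o2, o3⟩ := ho
      obtain ⟨p1, p2, p3⟩ := ho'
      obtain ⟨rfl, rfl, rfl⟩ := triple_unique e2 p2 p3 o2 o3
      rfl
    | _ => exact absurd hcard (by simp only [RootInvariant.zeroPoints]; decide)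

end Unique

/-! ## Zonotopes -/

section Zonotope

variable {ι : Type*} [Fintype ι]

/-- The zonotope which is the Minkowski sum of the segments `[-w k, w k]`. -/
def zonotope (w : ι → E3) : Set E3 := {x | ∃ s : ι → ℝ, (∀ k, |s k| ≤ 1) ∧ ∑ k, s k • w k = x}

theorem zonotope_eq_image (w : ι → E3) :
    zonotope w = Fintype.linearCombination ℝ w '' Set.Icc (-1) 1 := by
  ext x
  simp only [zonotope, Set.mem_ofPred_eq, Set.mem_image, Set.mem_Icc, Pi.le_def, ← forall_and,
    abs_le, Fintype.linearCombination_apply]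
  rfl

theorem convex_zonotope (w : ι → E3) : Convex ℝ (zonotope w) := by
  rw [zonotope_eq_image]
  exact (convex_Icc _ _).linear_image _

theorem isClosed_zonotope (w : ι → E3) : IsClosed (zonotope w) := by
  rw [zonotope_eq_image]
  exact (isCompact_Icc.image (LinearMap.continuous_of_finiteDimensional _)).isClosed

theorem mul_le_abs_of_abs_le_one {s a : ℝ} (hs : |s| ≤ 1) : s * a ≤ |a| := by
  calc s * a ≤ |s * a| := le_abs_self _
    _ = |s| * |a| := abs_mul _ _
    _ ≤ 1 * |a| := by gcongr
    _ = |a| := one_mul _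

theorem map_sum_smul_le {w : ι → E3} (l : StrongDual ℝ E3) {s : ι → ℝ} (hs : ∀ k, |s k| ≤ 1) :
    l (∑ k, s k • w k) ≤ ∑ k, |l (w k)| := by
  simp only [map_sum, map_smul, smul_eq_mul]
  exact Finset.sum_le_sum fun k _ => mul_le_abs_of_abs_le_one (hs k)

/-- The support function of a zonotope is a sum over the generators, so the maximum is attained only
generator by generator. -/
theorem map_sum_smul_eq_iff {w : ι → E3} (l : StrongDual ℝ E3) {s : ι → ℝ} (hs : ∀ k, |s k| ≤ 1) :
    l (∑ k, s k • w k) = ∑ k, |l (w k)| ↔ ∀ k, s k * l (w k) = |l (w k)| := by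
  simp only [map_sum, map_smul, smul_eq_mul]
  rw [Finset.sum_eq_sum_iff_of_le fun k _ => mul_le_abs_of_abs_le_one (hs k)]
  simp

/-- A point where a linear functional attains its maximum on a zonotope. -/
noncomputable def zonotopeArgmax (w : ι → E3) (l : StrongDual ℝ E3) : E3 :=
  ∑ k, (SignType.sign (l (w k)) : ℝ) • w k

theorem abs_sign_le_one (a : ℝ) : |(SignType.sign a : ℝ)| ≤ 1 := by
  rcases lt_trichotomy a 0 with h | rfl | h
  · simp [sign_neg h]
  · simp
  · simp [sign_pos h]

theorem zonotopeArgmax_mem (w : ι → E3) (l : StrongDual ℝ E3) :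
    zonotopeArgmax w l ∈ zonotope w :=
  ⟨_, fun _ => abs_sign_le_one _, rfl⟩

theorem map_zonotopeArgmax (w : ι → E3) (l : StrongDual ℝ E3) :
    l (zonotopeArgmax w l) = ∑ k, |l (w k)| :=
  (map_sum_smul_eq_iff l fun _ => abs_sign_le_one _).2 fun k => by rw [mul_comm, self_mul_sign]

/-- A zonotope is the intersection of its supporting half-spaces. -/
theorem mem_zonotope_of_forall_inner_le {w : ι → E3} {x : E3}
    (h : ∀ y : E3, inner ℝ y x ≤ ∑ k, |inner ℝ y (w k)|) : x ∈ zonotope w := by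
  by_contra hx
  obtain ⟨f, u, hf, hu⟩ := geometric_hahn_banach_closed_point (convex_zonotope w)
    (isClosed_zonotope w) hx
  have h1 := hf _ (zonotopeArgmax_mem w f)
  rw [map_zonotopeArgmax] at h1
  have h2 := h ((InnerProductSpace.toDual ℝ E3).symm f)
  simp only [InnerProductSpace.toDual_symm_apply] at h2
  linarith

/-- The face of a set exposed by a linear functional. -/
def exposedFace (A : Set E3) (l : StrongDual ℝ E3) : Set E3 := {x ∈ A | ∀ y ∈ A, l y ≤ l x}

theorem mem_exposedFace_zonotope {w : ι → E3} {l : StrongDual ℝ E3} {x : E3} :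
    x ∈ exposedFace (zonotope w) l ↔ x ∈ zonotope w ∧ l x = ∑ k, |l (w k)| := by
  refine and_congr_right fun hx => ⟨fun h => le_antisymm ?_ ?_, fun h y hy => ?_⟩
  · obtain ⟨s, hs, rfl⟩ := hx
    exact map_sum_smul_le l hs
  · rw [← map_zonotopeArgmax]
    exact h _ (zonotopeArgmax_mem w l)
  · obtain ⟨s, hs, rfl⟩ := hy
    rw [h]
    exact map_sum_smul_le l hs

theorem zonotopeArgmax_mem_exposedFace (w : ι → E3) (l : StrongDual ℝ E3) :
    zonotopeArgmax w l ∈ exposedFace (zonotope w) l :=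
  mem_exposedFace_zonotope.2 ⟨zonotopeArgmax_mem w l, map_zonotopeArgmax w l⟩

/-- Faces of a zonotope are encoded by the sign vectors of functionals on the generators; a smaller
face refines the zeros of the sign vector of a larger one. -/
theorem exposedFace_zonotope_subset_iff {w : ι → E3} {l l' : StrongDual ℝ E3} :
    exposedFace (zonotope w) l ⊆ exposedFace (zonotope w) l' ↔
      ∀ k, l' (w k) ≠ 0 → 0 < l (w k) * l' (w k) := by
  constructor
  -- Since `sign 0 = 0`, `zonotopeArgmax w l` is the centre of the face of `l`, so this single point
  -- detects the inclusion.
  · intro h k hk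
    have hm := (mem_exposedFace_zonotope.1 (h (zonotopeArgmax_mem_exposedFace w l))).2
    have hs := (map_sum_smul_eq_iff l' fun _ => abs_sign_le_one _).1 hm k
    have hpos := abs_pos.2 hk
    rw [← hs] at hpos
    rcases lt_trichotomy (l (w k)) 0 with h0 | h0 | h0
    · rw [sign_neg h0] at hpos
      simp only [SignType.coe_neg, SignType.coe_one] at hpos
      nlinarith
    · simp [h0] at hpos
    · rw [sign_pos h0] at hpos
      simp only [SignType.coe_one] at hpos
      nlinarith
  · rintro h x hx
    obtain ⟨⟨s, hs, rfl⟩, hl⟩ := mem_exposedFace_zonotope.1 hx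
    refine mem_exposedFace_zonotope.2 ⟨⟨s, hs, rfl⟩, ?_⟩
    rw [map_sum_smul_eq_iff l hs] at hl
    rw [map_sum_smul_eq_iff l' hs]
    intro k
    by_cases h0 : l' (w k) = 0
    · simp [h0]
    have hp := h k h0
    have hk := hl k
    rcases pos_and_pos_or_neg_and_neg_of_mul_pos hp with ⟨h1, h2⟩ | ⟨h1, h2⟩
    · rw [abs_of_pos h1] at hk
      rw [abs_of_pos h2, (mul_eq_right₀ h1.ne').1 hk, one_mul]
    · rw [abs_of_neg h1] at hk
      have : s k = -1 := mul_right_cancel₀ h1.ne (by linarith)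
      rw [abs_of_neg h2, this]
      ring

/-- A correspondence of linear functionals which respects inclusions of exposed faces gives an
isomorphism of face lattices. -/
theorem combEquiv_of_functionals {P Q : Set E3} (τ : StrongDual ℝ E3 → StrongDual ℝ E3)
    (hτ : Function.Surjective τ) (hP : ∀ l, (exposedFace P l).Nonempty)
    (hQ : ∀ l, (exposedFace Q l).Nonempty)
    (h : ∀ l l', exposedFace P l ⊆ exposedFace P l' ↔
      exposedFace Q (τ l) ⊆ exposedFace Q (τ l')) : CombEquiv P Q := by
  classical
  have hexp (A : Set E3) (l : StrongDual ℝ E3) : IsExposed ℝ A (exposedFace A l) :=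
    fun _ => ⟨l, rfl⟩
  -- The empty set counts as exposed and is sent to itself. Elsewhere the chosen functional is
  -- immaterial, because `h` in both directions sends equal faces to equal faces.
  let g (F : {F : Set E3 // IsExposed ℝ P F}) : {F : Set E3 // IsExposed ℝ Q F} :=
    if hF : F.1.Nonempty then ⟨exposedFace Q (τ (F.2 hF).choose), hexp _ _⟩
    else ⟨∅, fun h => absurd h Set.not_nonempty_empty⟩
  have g_pos (F : {F : Set E3 // IsExposed ℝ P F}) (hF : F.1.Nonempty) :
      ∃ l, F.1 = exposedFace P l ∧ (g F).1 = exposedFace Q (τ l) :=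
    ⟨(F.2 hF).choose, (F.2 hF).choose_spec, by simp only [g, dif_pos hF]⟩
  have g_neg (F : {F : Set E3 // IsExposed ℝ P F}) (hF : ¬ F.1.Nonempty) : (g F).1 = ∅ := by
    simp only [g, dif_neg hF]
  have hle (F G : {F : Set E3 // IsExposed ℝ P F}) : g F ≤ g G ↔ F ≤ G := by
    change (g F).1 ⊆ (g G).1 ↔ F.1 ⊆ G.1
    by_cases hF : F.1.Nonempty
    · obtain ⟨l, e, e'⟩ := g_pos F hF
      by_cases hG : G.1.Nonempty
      · obtain ⟨l', e₁, e₁'⟩ := g_pos G hG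
        rw [e, e', e₁, e₁', h]
      · rw [g_neg G hG, Set.not_nonempty_iff_eq_empty.1 hG, e, e', Set.subset_empty_iff,
          Set.subset_empty_iff]
        exact iff_of_false (hQ _).ne_empty (hP _).ne_empty
    · rw [g_neg F hF, Set.not_nonempty_iff_eq_empty.1 hF]
      simp
  refine ⟨RelIso.ofSurjective (OrderEmbedding.ofMapLEIff g hle) ?_⟩
  rintro ⟨F, hF⟩
  by_cases hne : F.Nonempty
  · obtain ⟨l', rfl⟩ := hF hne
    obtain ⟨l, rfl⟩ := hτ l'
    refine ⟨⟨exposedFace P l, hexp _ _⟩, Subtype.ext ?_⟩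
    obtain ⟨l₁, e, e'⟩ := g_pos ⟨exposedFace P l, hexp _ _⟩ (hP l)
    change (g _).1 = _
    rw [e']
    exact Set.Subset.antisymm ((h _ _).1 e.ge) ((h _ _).1 e.le)
  · refine ⟨⟨∅, fun h => absurd h Set.not_nonempty_empty⟩, Subtype.ext ?_⟩
    change (g _).1 = _
    rw [g_neg _ Set.not_nonempty_empty]
    exact (Set.not_nonempty_iff_eq_empty.1 hne).symm

/-- The combinatorial type of a zonotope does not change under linear isomorphisms and scalings of
its generators. -/
theorem combEquiv_zonotope {u u' : ι → E3} {c c' : ι → ℝ} (L : E3 ≃ₗ[ℝ] E3)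
    (hL : ∀ k, L (u k) = u' k) (hc : ∀ k, c k = 0 ↔ c' k = 0) :
    CombEquiv (zonotope fun k => c k • u k) (zonotope fun k => c' k • u' k) := by
  let L' := L.toContinuousLinearEquiv
  refine combEquiv_of_functionals (fun l => l.comp (L'.symm : E3 →L[ℝ] E3)) ?_
    (fun l => ⟨_, zonotopeArgmax_mem_exposedFace _ l⟩)
    (fun l => ⟨_, zonotopeArgmax_mem_exposedFace _ l⟩) ?_
  · intro l
    refine ⟨l.comp (L' : E3 →L[ℝ] E3), ?_⟩
    ext x
    simp
  · intro l l'
    rw [exposedFace_zonotope_subset_iff, exposedFace_zonotope_subset_iff]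
    refine forall_congr' fun k => ?_
    have hk : L'.symm (u' k) = u k := by
      rw [← hL k]
      exact L.symm_apply_apply _
    simp only [map_smul, smul_eq_mul, ContinuousLinearMap.comp_apply,
      ContinuousLinearEquiv.coe_coe, hk]
    have e (c a b : ℝ) : (c * a) * (c * b) = c ^ 2 * (a * b) := by ring
    rw [e, e]
    by_cases h0 : c k = 0
    · simp [h0, (hc k).1 h0]
    · have h0' : c' k ≠ 0 := fun h => h0 ((hc k).2 h)
      rw [mul_pos_iff_of_pos_left (by positivity : 0 < c k ^ 2),
        mul_pos_iff_of_pos_left (by positivity : 0 < c' k ^ 2)]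
      simp [h0, h0']

end Zonotope

/-! ## The Voronoi domain is a zonotope -/

/-- The six differences of `0, d 0, d 1, d 2`. -/
def edgeVectors (d : Fin 3 → E3) : Fin 6 → E3 :=
  ![d 0, d 1, d 2, d 0 - d 1, d 0 - d 2, d 1 - d 2]

/-- The six conorms of a superbase. -/
noncomputable def conorms (B : Fin 4 → E3) : Fin 6 → ℝ :=
  ![conorm B 0 1, conorm B 0 2, conorm B 0 3, conorm B 1 2, conorm B 1 3, conorm B 2 3]

theorem mem_voronoiDomain_iff {Λ : Submodule ℤ E3} {x : E3} :
    x ∈ voronoiDomain Λ ↔ ∀ v ∈ Λ, 2 * inner ℝ x v ≤ ‖v‖ ^ 2 := by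
  refine forall₂_congr fun v _ => ?_
  rw [← sq_le_sq₀ (norm_nonneg _) (norm_nonneg _), norm_sub_sq_real]
  constructor <;> intro h <;> linarith

section Voronoi

variable {Λ : Submodule ℤ E3} {B : Fin 4 → E3}

/-- Abel summation writes the vector as a combination of `B 1 + B 2 + B 3`, `B 2 + B 3` and `B 3`
whose weights are the increments of `t`. The Voronoi inequalities for these three lattice vectors,
with norms from Selling's formula, add up to the bound. The factor 4 is 2 from those inequalities
times 2 from summing over ordered pairs. -/
theorem inner_sum_le_of_monotone (h : IsObtuseSuperbase Λ B) {x : E3} (hx : x ∈ voronoiDomain Λ)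
    {t : Fin 4 → ℝ} (ht : Monotone t) :
    4 * inner ℝ x (∑ i, t i • B i) ≤ ∑ i, ∑ j, conorm B i j * |t i - t j| := by
  rw [mem_voronoiDomain_iff] at hx
  have hB := h.sum_eq_zero
  have hm (i : Fin 3) : B i.succ ∈ Λ := by
    rw [← h.coe_basis i]; exact (h.basis i).2
  have h1 := hx _ (add_mem (add_mem (hm 0) (hm 1)) (hm 2))
  have h2 := hx _ (add_mem (hm 1) (hm 2))
  have h3 := hx _ (hm 2)
  have n1 := norm_sq_sum_smul hB ![0, 1, 1, 1]
  have n2 := norm_sq_sum_smul hB ![0, 0, 1, 1]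
  have n3 := norm_sq_sum_smul hB ![0, 0, 0, 1]
  simp [Fin.sum_univ_four] at n1 n2 n3
  change 2 * inner ℝ x (B 1 + B 2 + B 3) ≤ ‖B 1 + B 2 + B 3‖ ^ 2 at h1
  change 2 * inner ℝ x (B 2 + B 3) ≤ ‖B 2 + B 3‖ ^ 2 at h2
  change 2 * inner ℝ x (B 3) ≤ ‖B 3‖ ^ 2 at h3
  rw [n1] at h1
  rw [n2] at h2
  rw [n3] at h3
  have t1 : t 0 ≤ t 1 := ht (by decide)
  have t2 : t 1 ≤ t 2 := ht (by decide)
  have t3 : t 2 ≤ t 3 := ht (by decide)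
  have h0 : inner ℝ x (B 0) = -inner ℝ x (B 1) - inner ℝ x (B 2) - inner ℝ x (B 3) := by
    rw [h.zero_eq, inner_sub_right, inner_sub_right, inner_neg_right]
  have hdiag (i : Fin 4) : conorm B i i * |t i - t i| = 0 := by simp
  have hlt {i j : Fin 4} (hij : t i ≤ t j) : |t i - t j| = t j - t i := by
    rw [abs_sub_comm, abs_of_nonneg (by linarith)]
  have hgt {i j : Fin 4} (hij : t i ≤ t j) : |t j - t i| = t j - t i := by
    rw [abs_of_nonneg (by linarith)]
  have t4 := t1.trans t2
  have t5 := t2.trans t3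
  have t6 := t4.trans t3
  simp only [Fin.sum_univ_four, hdiag]
  rw [hlt t1, hlt t2, hlt t3, hlt t4, hlt t5, hlt t6, hgt t1, hgt t2, hgt t3, hgt t4, hgt t5,
    hgt t6, conorm_comm B 1 0, conorm_comm B 2 0, conorm_comm B 3 0, conorm_comm B 2 1,
    conorm_comm B 3 1, conorm_comm B 3 2]
  simp only [inner_add_right, inner_smul_right, h0] at h1 h2 ⊢
  have m1 := mul_le_mul_of_nonneg_left h1 (sub_nonneg.2 t1)
  have m2 := mul_le_mul_of_nonneg_left h2 (sub_nonneg.2 t2)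
  have m3 := mul_le_mul_of_nonneg_left h3 (sub_nonneg.2 t3)
  linarith

theorem inner_sum_le [DiscreteTopology Λ] [IsZLattice ℝ Λ] (h : IsObtuseSuperbase Λ B) {x : E3}
    (hx : x ∈ voronoiDomain Λ) (t : Fin 4 → ℝ) :
    4 * inner ℝ x (∑ i, t i • B i) ≤ ∑ i, ∑ j, conorm B i j * |t i - t j| := by
  let σ := Tuple.sort t
  have := inner_sum_le_of_monotone (h.comp_perm σ) hx (Tuple.monotone_sort t)
  have e1 : ∑ i, (t ∘ σ) i • (B ∘ σ) i = ∑ i, t i • B i := Equiv.sum_comp σ fun i => t i • B i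
  have e2 : ∑ i, ∑ j, conorm (B ∘ σ) i j * |(t ∘ σ) i - (t ∘ σ) j| =
      ∑ i, ∑ j, conorm B i j * |t i - t j| := by
    rw [← Equiv.sum_comp σ fun i => ∑ j, conorm B i j * |t i - t j|]
    refine Finset.sum_congr rfl fun i _ => ?_
    exact Equiv.sum_comp σ fun j => conorm B (σ i) j * |t (σ i) - t j|
  rwa [e1, e2] at this

theorem IsObtuseSuperbase.exists_sum_eq (h : IsObtuseSuperbase Λ B) (y : E3) :
    ∃ t : Fin 3 → ℝ, y = ∑ i, t i • B i.succ := by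
  let b := basisOfLinearIndependentOfCardEqFinrank h.linearIndependent (by simp)
  refine ⟨b.repr y, ?_⟩
  conv_lhs => rw [← b.sum_repr y]
  refine Finset.sum_congr rfl fun i _ => ?_
  simp only [b, coe_basisOfLinearIndependentOfCardEqFinrank]
  fin_cases i <;> rfl

/-- Vectors are determined by their inner products with `v₁, v₂, v₃`. -/
theorem IsObtuseSuperbase.eq_zero_of_inner (h : IsObtuseSuperbase Λ B) {x : E3}
    (hx : ∀ i : Fin 3, inner ℝ x (B i.succ) = 0) : x = 0 := by
  obtain ⟨t, ht⟩ := h.exists_sum_eq x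
  rw [← inner_self_eq_zero (𝕜 := ℝ)]
  nth_rewrite 2 [ht]
  simp [inner_sum, inner_smul_right, hx]

/-- The linear isomorphism mapping the basis dual to `v₁, v₂, v₃` to a given basis. -/
theorem IsObtuseSuperbase.exists_linearEquiv (h : IsObtuseSuperbase Λ B) {m : Fin 3 → E3}
    (hm : LinearIndependent ℝ m) :
    ∃ L : E3 ≃ₗ[ℝ] E3, ∀ x, L x = ∑ i : Fin 3, inner ℝ x (B i.succ) • m i := by
  let f : E3 →ₗ[ℝ] E3 :=
    { toFun x := ∑ i : Fin 3, inner ℝ x (B i.succ) • m i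
      map_add' x y := by simp only [inner_add_left, add_smul, Finset.sum_add_distrib]
      map_smul' c x := by
        simp only [real_inner_smul_left, mul_smul, Finset.smul_sum, RingHom.id_apply] }
  have hf : Function.Injective f := by
    rw [injective_iff_map_eq_zero]
    intro x hx
    exact h.eq_zero_of_inner fun i => Fintype.linearIndependent_iff.1 hm
      (fun i => inner ℝ x (B i.succ)) hx i
  exact ⟨LinearEquiv.ofInjectiveEndo f hf, fun x => rfl⟩

theorem IsObtuseSuperbase.exists_dual (h : IsObtuseSuperbase Λ B) :
    ∃ d : Fin 3 → E3, ∀ i j : Fin 3, inner ℝ (d i) (B j.succ) = if i = j then (1 : ℝ) else 0 := by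
  let b := basisOfLinearIndependentOfCardEqFinrank h.linearIndependent (by simp)
  obtain ⟨L, hL⟩ := h.exists_linearEquiv b.linearIndependent
  refine ⟨fun i => L.symm (b i), fun i j => ?_⟩
  have e : b.repr (L (L.symm (b i))) j = b.repr (b i) j := by rw [L.apply_symm_apply]
  rw [hL, b.repr_sum_self, b.repr_self, Finsupp.single_apply] at e
  exact e

theorem inner_edgeVectors {d : Fin 3 → E3}
    (hd : ∀ i j : Fin 3, inner ℝ (d i) (B j.succ) = if i = j then (1 : ℝ) else 0)
    (t : Fin 3 → ℝ) (k : Fin 6) : inner ℝ (edgeVectors d k) (∑ i, t i • B i.succ) =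
      (![t 0, t 1, t 2, t 0 - t 1, t 0 - t 2, t 1 - t 2] : Fin 6 → ℝ) k := by
  have e (i : Fin 3) : inner ℝ (d i) (∑ i, t i • B i.succ) = t i := by
    simp [inner_sum, inner_smul_right, hd]
  fin_cases k
  · exact e 0
  · exact e 1
  · exact e 2
  · exact (inner_sub_left _ _ _).trans (by rw [e, e]; rfl)
  · exact (inner_sub_left _ _ _).trans (by rw [e, e]; rfl)
  · exact (inner_sub_left _ _ _).trans (by rw [e, e]; rfl)

theorem mul_intCast_le_sq {s : ℝ} (hs : |s| ≤ 1) (n : ℤ) : s * n ≤ (n : ℝ) ^ 2 := by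
  refine (mul_le_abs_of_abs_le_one hs).trans ?_
  rw [← sq_abs]
  have h : |n| ≤ |n| ^ 2 := by simpa using Int.le_self_sq |n|
  exact_mod_cast h

/-- One inclusion compares support functions by `inner_sum_le`. For the other, Selling's formula
turns each Voronoi inequality into a sum of inequalities `s * m ≤ m ^ 2` with `m` an integer and
`|s| ≤ 1`. -/
theorem voronoiDomain_eq_zonotope [DiscreteTopology Λ] [IsZLattice ℝ Λ]
    (h : IsObtuseSuperbase Λ B) {d : Fin 3 → E3}
    (hd : ∀ i j : Fin 3, inner ℝ (d i) (B j.succ) = if i = j then (1 : ℝ) else 0) :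
    voronoiDomain Λ = zonotope fun k => (conorms B k / 2) • edgeVectors d k := by
  have c {i j : Fin 4} (hij : i ≠ j) := h.conorm_nonneg hij
  apply Set.Subset.antisymm
  · intro x hx
    apply mem_zonotope_of_forall_inner_le
    intro y
    obtain ⟨t, rfl⟩ := h.exists_sum_eq y
    have key := inner_sum_le h hx (Fin.cons 0 t)
    have e0 : (Fin.cons 0 t : Fin 4 → ℝ) 0 = 0 := rfl
    have e1 : (Fin.cons 0 t : Fin 4 → ℝ) 1 = t 0 := rfl
    have e2 : (Fin.cons 0 t : Fin 4 → ℝ) 2 = t 1 := rfl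
    have e3 : (Fin.cons 0 t : Fin 4 → ℝ) 3 = t 2 := rfl
    rw [Fin.sum_univ_succ (n := 3), Fin.cons_zero, zero_smul, zero_add] at key
    simp only [Fin.cons_succ] at key
    simp only [Fin.sum_univ_four, e0, e1, e2, e3, sub_self, zero_sub, sub_zero, abs_zero, abs_neg,
      mul_zero] at key
    rw [conorm_comm B 1 0, conorm_comm B 2 0, conorm_comm B 3 0, conorm_comm B 2 1,
      conorm_comm B 3 1, conorm_comm B 3 2, abs_sub_comm (t 1) (t 0), abs_sub_comm (t 2) (t 0),
      abs_sub_comm (t 2) (t 1)] at key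
    simp only [inner_smul_right, real_inner_comm (edgeVectors d _), inner_edgeVectors hd, abs_mul]
    rw [real_inner_comm, Fin.sum_univ_six]
    simp only [conorms, Matrix.cons_val]
    have c2 {i j : Fin 4} (hij : i ≠ j) : |conorm B i j / 2| = conorm B i j / 2 :=
      abs_of_nonneg (div_nonneg (c hij) zero_le_two)
    rw [c2 (by decide), c2 (by decide), c2 (by decide), c2 (by decide), c2 (by decide),
      c2 (by decide)]
    linarith
  · rintro _ ⟨s, hs, rfl⟩
    rw [mem_voronoiDomain_iff]
    intro v hv
    have hn := h.norm_sq_eq ⟨v, hv⟩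
    set n := h.basis.repr ⟨v, hv⟩ with hn_def
    have hv' : v = ∑ i, (n i : ℝ) • B i.succ := by
      have := congrArg (Subtype.val) (h.basis.sum_repr ⟨v, hv⟩)
      rw [Submodule.coe_sum] at this
      refine this.symm.trans ?_
      refine Finset.sum_congr rfl fun i _ => ?_
      rw [Submodule.coe_smul, h.coe_basis, Int.cast_smul_eq_zsmul]
    change ‖v‖ ^ 2 = _ at hn
    rw [hn]
    nth_rewrite 1 [hv']
    rw [sum_inner]
    simp only [real_inner_smul_left, inner_edgeVectors hd, Fin.sum_univ_six, conorms,
      Matrix.cons_val]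
    have key (k : Fin 6) (m : ℤ) {i j : Fin 4} (hij : i ≠ j) :
        conorm B i j * (s k * m) ≤ conorm B i j * (m : ℝ) ^ 2 :=
      mul_le_mul_of_nonneg_left (mul_intCast_le_sq (hs k) m) (c hij)
    have k0 := key 0 (n 0) (i := 0) (j := 1) (by decide)
    have k1 := key 1 (n 1) (i := 0) (j := 2) (by decide)
    have k2 := key 2 (n 2) (i := 0) (j := 3) (by decide)
    have k3 := key 3 (n 0 - n 1) (i := 1) (j := 2) (by decide)
    have k4 := key 4 (n 0 - n 2) (i := 1) (j := 3) (by decide)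
    have k5 := key 5 (n 1 - n 2) (i := 2) (j := 3) (by decide)
    push_cast at k3 k4 k5
    linarith

/-- The combinatorial type of the Voronoi domain only depends on the zero conorms. -/
theorem combEquiv_voronoiDomain [DiscreteTopology Λ] [IsZLattice ℝ Λ]
    (h : IsObtuseSuperbase Λ B) {m : Fin 3 → E3} (hm : LinearIndependent ℝ m) {c : Fin 6 → ℝ}
    (hc : ∀ k, conorms B k = 0 ↔ c k = 0) :
    CombEquiv (voronoiDomain Λ) (zonotope fun k => c k • edgeVectors m k) := by
  obtain ⟨d, hd⟩ := h.exists_dual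
  obtain ⟨L, hL⟩ := h.exists_linearEquiv hm
  rw [voronoiDomain_eq_zonotope h hd]
  have hLd (i : Fin 3) : L (d i) = m i := by simp [hL, hd]
  refine combEquiv_zonotope L (fun k => ?_) fun k => by rw [← hc k]; simp
  fin_cases k
  · exact hLd 0
  · exact hLd 1
  · exact hLd 2
  · exact (map_sub L _ _).trans (by rw [hLd, hLd]; rfl)
  · exact (map_sub L _ _).trans (by rw [hLd, hLd]; rfl)
  · exact (map_sub L _ _).trans (by rw [hLd, hLd]; rfl)

end Voronoi

/-! ## The five model polytopes are zonotopes -/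

section Models

theorem inner_eq_sum_three (y x : E3) : inner ℝ y x = y 0 * x 0 + y 1 * x 1 + y 2 * x 2 := by
  simp [PiLp.inner_apply, Fin.sum_univ_three, mul_comm]

theorem abs_add_abs_le_of {u v C : ℝ} (h1 : u + v ≤ C) (h2 : u - v ≤ C) (h3 : -u + v ≤ C)
    (h4 : -u - v ≤ C) : |u| + |v| ≤ C := by
  rcases abs_cases u with ⟨h, _⟩ | ⟨h, _⟩ <;> rcases abs_cases v with ⟨h', _⟩ | ⟨h', _⟩ <;>
    rw [h, h'] <;> linarith

theorem mul_add_three_le (a b c x y z : ℝ) :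
    a * x + b * y + c * z ≤ |a| * |x| + |b| * |y| + |c| * |z| := by
  have h (u v : ℝ) : u * v ≤ |u| * |v| := by rw [← abs_mul]; exact le_abs_self _
  linarith [h a x, h b y, h c z]

theorem two_abs_le_left (a b : ℝ) : 2 * |a| ≤ |a + b| + |a - b| := by
  have := abs_add_le (a + b) (a - b)
  rwa [show a + b + (a - b) = 2 * a by ring, abs_mul, abs_two] at this

theorem two_abs_le_right (a b : ℝ) : 2 * |b| ≤ |a + b| + |a - b| := by
  have := abs_sub (a + b) (a - b)
  rwa [show a + b - (a - b) = 2 * b by ring, abs_mul, abs_two] at this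

/-- Basis for the generators of the truncated octahedron. -/
noncomputable def octahedronBasis : Fin 3 → E3 := ![!₂[1, 1, 0], !₂[1, 0, 1], !₂[0, 1, 1]]

/-- Basis for the generators of both dodecahedra. -/
noncomputable def dodecahedronBasis : Fin 3 → E3 := ![!₂[0, 0, 2], !₂[1, 1, 1], !₂[1, -1, 1]]

/-- Basis for the generators of the hexagonal prism and the cuboid. -/
noncomputable def cubeBasis : Fin 3 → E3 := ![!₂[1, 0, 0], !₂[0, 1, 0], !₂[0, 0, 1]]

theorem linearIndependent_octahedronBasis : LinearIndependent ℝ octahedronBasis := by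
  rw [Fintype.linearIndependent_iff]
  intro g hg
  have h0 := congrArg (fun v : E3 => v 0) hg
  have h1 := congrArg (fun v : E3 => v 1) hg
  have h2 := congrArg (fun v : E3 => v 2) hg
  simp [Fin.sum_univ_three, octahedronBasis] at h0 h1 h2
  intro i
  fin_cases i <;> simp <;> linarith

theorem linearIndependent_dodecahedronBasis : LinearIndependent ℝ dodecahedronBasis := by
  rw [Fintype.linearIndependent_iff]
  intro g hg
  have h0 := congrArg (fun v : E3 => v 0) hg
  have h1 := congrArg (fun v : E3 => v 1) hg
  have h2 := congrArg (fun v : E3 => v 2) hg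
  simp [Fin.sum_univ_three, dodecahedronBasis] at h0 h1 h2
  intro i
  fin_cases i <;> simp <;> linarith

theorem linearIndependent_cubeBasis : LinearIndependent ℝ cubeBasis := by
  rw [Fintype.linearIndependent_iff]
  intro g hg
  have h0 := congrArg (fun v : E3 => v 0) hg
  have h1 := congrArg (fun v : E3 => v 1) hg
  have h2 := congrArg (fun v : E3 => v 2) hg
  simp [Fin.sum_univ_three, cubeBasis] at h0 h1 h2
  intro i
  fin_cases i <;> simp <;> linarith

theorem inner_octahedronBasis (y : E3) (k : Fin 6) : inner ℝ y (edgeVectors octahedronBasis k) =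
    ![y 0 + y 1, y 0 + y 2, y 1 + y 2, y 1 - y 2, y 0 - y 2, y 0 - y 1] k := by
  fin_cases k <;> simp [edgeVectors, octahedronBasis, inner_eq_sum_three] <;> ring

theorem inner_dodecahedronBasis (y : E3) (k : Fin 6) :
    inner ℝ y (edgeVectors dodecahedronBasis k) =
    ![2 * y 2, y 0 + y 1 + y 2, y 0 - y 1 + y 2, y 2 - y 0 - y 1, y 2 - y 0 + y 1, 2 * y 1] k := by
  fin_cases k <;> simp [edgeVectors, dodecahedronBasis, inner_eq_sum_three] <;> ring

theorem inner_cubeBasis (y : E3) (k : Fin 6) : inner ℝ y (edgeVectors cubeBasis k) =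
    ![y 0, y 1, y 2, y 0 - y 1, y 0 - y 2, y 1 - y 2] k := by
  fin_cases k <;> simp [edgeVectors, cubeBasis, inner_eq_sum_three] <;> ring

/-- The maximum is at the vertex `(2, 1, 0)`, by Abel summation against the three constraints. -/
theorem octahedron_sorted_le {A B C X Y Z : ℝ} (hAB : B ≤ A) (hBC : C ≤ B) (hC : 0 ≤ C)
    (hZ : 0 ≤ Z) (hX : X ≤ 2) (hs : X + Y + Z ≤ 3) : A * X + B * Y + C * Z ≤ 2 * A + B := by
  have h1 := mul_nonneg (sub_nonneg.2 hAB) (sub_nonneg.2 hX)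
  have h2 := mul_nonneg (sub_nonneg.2 hBC) (by linarith : 0 ≤ 3 - X - Y)
  have h3 := mul_nonneg hC (sub_nonneg.2 hs)
  linarith

theorem octahedron_support_le {a b c x y z : ℝ} (hx : |x| ≤ 2) (hy : |y| ≤ 2) (hz : |z| ≤ 2)
    (hs : |x| + |y| + |z| ≤ 3) : a * x + b * y + c * z ≤
      1 / 2 * (|a + b| + |a + c| + |b + c| + |b - c| + |a - c| + |a - b|) := by
  refine (mul_add_three_le a b c x y z).trans ?_
  have x0 := abs_nonneg x
  have y0 := abs_nonneg y
  have z0 := abs_nonneg z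
  have a0 := abs_nonneg a
  have b0 := abs_nonneg b
  have c0 := abs_nonneg c
  -- Each pair contributes `|a + b| + |a - b| = 2 max(|a|, |b|)`, so half the total is twice the
  -- largest plus the middle absolute value.
  have l1 := two_abs_le_left a b
  have l2 := two_abs_le_left a c
  have l3 := two_abs_le_left b c
  have r1 := two_abs_le_right a b
  have r2 := two_abs_le_right a c
  have r3 := two_abs_le_right b c
  rcases le_total |a| |b| with h1 | h1 <;> rcases le_total |a| |c| with h2 | h2 <;>
    rcases le_total |b| |c| with h3 | h3
  · linarith [octahedron_sorted_le h3 h1 a0 x0 hz (by linarith : |z| + |y| + |x| ≤ 3)]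
  · linarith [octahedron_sorted_le h3 h2 a0 x0 hy (by linarith : |y| + |z| + |x| ≤ 3)]
  · linarith [octahedron_sorted_le h3 h1 a0 x0 hz (by linarith : |z| + |y| + |x| ≤ 3)]
  · linarith [octahedron_sorted_le h1 h2 c0 z0 hy (by linarith : |y| + |x| + |z| ≤ 3)]
  · linarith [octahedron_sorted_le h2 h1 b0 y0 hz (by linarith : |z| + |x| + |y| ≤ 3)]
  · linarith [octahedron_sorted_le h2 h1 b0 y0 hz (by linarith : |z| + |x| + |y| ≤ 3)]
  · linarith [octahedron_sorted_le h2 h3 b0 y0 hx (by linarith : |x| + |z| + |y| ≤ 3)]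
  · linarith [octahedron_sorted_le h1 h3 c0 z0 hx hs]

/-- The generators are, up to sign and scale, the positive roots of the root system `A₃ = D₃`. -/
theorem truncatedOctahedron_eq : truncatedOctahedron =
    zonotope fun k => (![1 / 2, 1 / 2, 1 / 2, 1 / 2, 1 / 2, 1 / 2] : Fin 6 → ℝ) k •
      edgeVectors octahedronBasis k := by
  apply Set.Subset.antisymm
  · rintro p ⟨h0, h1, h2, h3⟩
    apply mem_zonotope_of_forall_inner_le
    intro y
    have := octahedron_support_le (a := y 0) (b := y 1) (c := y 2) h0 h1 h2 h3
    simp only [inner_smul_right, inner_octahedronBasis, Fin.sum_univ_six, Matrix.cons_val, abs_mul]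
    rw [inner_eq_sum_three, abs_of_pos (by norm_num : (0 : ℝ) < 1 / 2)]
    linarith
  · rintro _ ⟨s, hs, rfl⟩
    have hs' (k : Fin 6) := abs_le.1 (hs k)
    have s0 := hs' 0
    have s1 := hs' 1
    have s2 := hs' 2
    have s3 := hs' 3
    have s4 := hs' 4
    have s5 := hs' 5
    simp [truncatedOctahedron, Fin.sum_univ_six, edgeVectors, octahedronBasis]
    refine ⟨?_, ?_, ?_, ?_⟩
    · rw [abs_le]; constructor <;> linarith
    · rw [abs_le]; constructor <;> linarith
    · rw [abs_le]; constructor <;> linarith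
    · rw [← le_sub_iff_add_le]
      apply abs_add_abs_le_of <;> rw [le_sub_comm, abs_le] <;> constructor <;> linarith

theorem four_abs_le (a b c : ℝ) :
    let S := |a + b + c| + |a - b + c| + |c - a - b| + |c - a + b|
    4 * |a| ≤ S ∧ 4 * |b| ≤ S ∧ 4 * |c| ≤ S ∧ 2 * (|a| + |b| + |c|) ≤ S := by
  intro S
  have p1 := le_abs_self (a + b + c)
  have p2 := le_abs_self (a - b + c)
  have p3 := le_abs_self (c - a - b)
  have p4 := le_abs_self (c - a + b)
  have q1 := neg_le_abs (a + b + c)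
  have q2 := neg_le_abs (a - b + c)
  have q3 := neg_le_abs (c - a - b)
  have q4 := neg_le_abs (c - a + b)
  simp only [S]
  rcases abs_cases a with ⟨ha, _⟩ | ⟨ha, _⟩ <;> rcases abs_cases b with ⟨hb, _⟩ | ⟨hb, _⟩ <;>
    rcases abs_cases c with ⟨hc, _⟩ | ⟨hc, _⟩ <;> rw [ha, hb, hc] <;>
    refine ⟨?_, ?_, ?_, ?_⟩ <;> linarith

/-- The bound `q = 1` gives the rhombic dodecahedron, `q = 2` the elongated one. -/
theorem dodecahedron_support_le {a b c x y z q : ℝ} (hxy : |x| + |y| ≤ 1) (hxz : |x| + |z| ≤ q)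
    (hyz : |y| + |z| ≤ q) : a * x + b * y + c * z ≤
      1 / 4 * (|a + b + c| + |a - b + c| + |c - a - b| + |c - a + b|) + (q - 1) * |c| := by
  refine (mul_add_three_le a b c x y z).trans ?_
  obtain ⟨h1, h2, h3, h4⟩ := four_abs_le a b c
  generalize |a + b + c| + |a - b + c| + |c - a - b| + |c - a + b| = S at *
  have x0 := abs_nonneg x
  have y0 := abs_nonneg y
  have z0 := abs_nonneg z
  have a0 := abs_nonneg a
  have b0 := abs_nonneg b
  have c0 := abs_nonneg c
  -- Linear programming duality: the cases are distinguished by which multipliers of the constraints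
  -- are non-negative. In the last one no absolute value dominates and all three given constraints
  -- are tight.
  rcases le_total (|b| + |c|) |a| with ha | ha
  · have m1 := mul_nonneg b0 (sub_nonneg.2 hxy)
    have m2 := mul_nonneg c0 (sub_nonneg.2 hxz)
    have m3 := mul_nonneg (sub_nonneg.2 ha) (by linarith : 0 ≤ 1 - |x|)
    linarith
  rcases le_total (|a| + |c|) |b| with hb | hb
  · have m1 := mul_nonneg a0 (sub_nonneg.2 hxy)
    have m2 := mul_nonneg c0 (sub_nonneg.2 hyz)
    have m3 := mul_nonneg (sub_nonneg.2 hb) (by linarith : 0 ≤ 1 - |y|)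
    linarith
  rcases le_total (|a| + |b|) |c| with hc | hc
  · have m1 := mul_nonneg a0 (sub_nonneg.2 hxz)
    have m2 := mul_nonneg b0 (sub_nonneg.2 hyz)
    have m3 := mul_nonneg (sub_nonneg.2 hc) (by linarith : 0 ≤ q - |z|)
    linarith
  · have m1 := mul_nonneg (sub_nonneg.2 hc) (sub_nonneg.2 hxy)
    have m2 := mul_nonneg (sub_nonneg.2 hb) (sub_nonneg.2 hxz)
    have m3 := mul_nonneg (sub_nonneg.2 ha) (sub_nonneg.2 hyz)
    linarith

/-- The four generators with coefficient `1 / 4` are the diagonals of a cube, whose sum is the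
rhombic dodecahedron; the first generator elongates it vertically. -/
theorem hexaRhombicDodecahedron_eq : hexaRhombicDodecahedron =
    zonotope fun k => (![1 / 2, 1 / 4, 1 / 4, 1 / 4, 1 / 4, 0] : Fin 6 → ℝ) k •
      edgeVectors dodecahedronBasis k := by
  apply Set.Subset.antisymm
  · rintro p ⟨h0, h1, h2⟩
    apply mem_zonotope_of_forall_inner_le
    intro y
    have := dodecahedron_support_le (a := y 0) (b := y 1) (c := y 2) h0 h1 h2
    simp only [inner_smul_right, inner_dodecahedronBasis, Fin.sum_univ_six, Matrix.cons_val,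
      abs_mul]
    rw [inner_eq_sum_three, abs_of_pos (by norm_num : (0 : ℝ) < 1 / 4),
      abs_of_pos (by norm_num : (0 : ℝ) < 1 / 2), abs_two, abs_zero]
    linarith
  · rintro _ ⟨s, hs, rfl⟩
    have hs' (k : Fin 6) := abs_le.1 (hs k)
    have s0 := hs' 0
    have s1 := hs' 1
    have s2 := hs' 2
    have s3 := hs' 3
    have s4 := hs' 4
    simp [hexaRhombicDodecahedron, Fin.sum_univ_six, edgeVectors, dodecahedronBasis]
    refine ⟨?_, ?_, ?_⟩ <;> apply abs_add_abs_le_of <;> linarith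

theorem rhombicDodecahedron_eq : rhombicDodecahedron =
    zonotope fun k => (![0, 1 / 4, 1 / 4, 1 / 4, 1 / 4, 0] : Fin 6 → ℝ) k •
      edgeVectors dodecahedronBasis k := by
  apply Set.Subset.antisymm
  · rintro p ⟨h0, h1, h2⟩
    apply mem_zonotope_of_forall_inner_le
    intro y
    have := dodecahedron_support_le (a := y 0) (b := y 1) (c := y 2) h0 h1 h2
    simp only [inner_smul_right, inner_dodecahedronBasis, Fin.sum_univ_six, Matrix.cons_val,
      abs_mul]
    rw [inner_eq_sum_three, abs_of_pos (by norm_num : (0 : ℝ) < 1 / 4), abs_zero]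
    linarith
  · rintro _ ⟨s, hs, rfl⟩
    have hs' (k : Fin 6) := abs_le.1 (hs k)
    have s1 := hs' 1
    have s2 := hs' 2
    have s3 := hs' 3
    have s4 := hs' 4
    simp [rhombicDodecahedron, Fin.sum_univ_six, edgeVectors, dodecahedronBasis]
    refine ⟨?_, ?_, ?_⟩ <;> apply abs_add_abs_le_of <;> linarith

theorem hexagon_support_le {a b x y : ℝ} (hx : |x| ≤ 1) (hy : |y| ≤ 1) (hxy : |x + y| ≤ 1) :
    a * x + b * y ≤ 1 / 2 * (|a| + |b| + |a - b|) := by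
  have hy' : |-y| ≤ 1 := by rwa [abs_neg]
  have k1 := mul_le_abs_of_abs_le_one (a := a - b) hx
  have k2 := mul_le_abs_of_abs_le_one (a := a - b) hy'
  have k3 := mul_le_abs_of_abs_le_one (a := a) hxy
  have k4 := mul_le_abs_of_abs_le_one (a := b) hxy
  have k5 := mul_le_abs_of_abs_le_one (a := a) hx
  have k6 := mul_le_abs_of_abs_le_one (a := b) hy
  rcases abs_cases a with ⟨ha, _⟩ | ⟨ha, _⟩ <;> rcases abs_cases b with ⟨hb, _⟩ | ⟨hb, _⟩ <;>
    rcases abs_cases (a - b) with ⟨hc, _⟩ | ⟨hc, _⟩ <;>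
    linarith

theorem hexagonalPrism_eq : hexagonalPrism =
    zonotope fun k => (![1 / 2, 1 / 2, 1, 1 / 2, 0, 0] : Fin 6 → ℝ) k •
      edgeVectors cubeBasis k := by
  apply Set.Subset.antisymm
  · rintro p ⟨h0, h1, h2, h3⟩
    apply mem_zonotope_of_forall_inner_le
    intro y
    have h4 := hexagon_support_le (a := y 0) (b := y 1) h0 h1 h2
    have h5 := mul_le_abs_of_abs_le_one (a := y 2) h3
    simp only [inner_smul_right, inner_cubeBasis, Fin.sum_univ_six, Matrix.cons_val, abs_mul]
    rw [inner_eq_sum_three, abs_of_pos (by norm_num : (0 : ℝ) < 1 / 2), abs_one, abs_zero]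
    linarith
  · rintro _ ⟨s, hs, rfl⟩
    have hs' (k : Fin 6) := abs_le.1 (hs k)
    have s0 := hs' 0
    have s1 := hs' 1
    have s2 := hs' 2
    have s3 := hs' 3
    simp [hexagonalPrism, Fin.sum_univ_six, edgeVectors, cubeBasis]
    refine ⟨?_, ?_, ?_, hs 2⟩ <;> rw [abs_le] <;> constructor <;> linarith

theorem cuboid_eq : cuboid =
    zonotope fun k => (![1, 1, 1, 0, 0, 0] : Fin 6 → ℝ) k • edgeVectors cubeBasis k := by
  apply Set.Subset.antisymm
  · rintro p ⟨h0, h1, h2⟩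
    apply mem_zonotope_of_forall_inner_le
    intro y
    have h3 := mul_le_abs_of_abs_le_one (a := y 0) h0
    have h4 := mul_le_abs_of_abs_le_one (a := y 1) h1
    have h5 := mul_le_abs_of_abs_le_one (a := y 2) h2
    simp only [inner_smul_right, inner_cubeBasis, Fin.sum_univ_six, Matrix.cons_val, abs_mul]
    rw [inner_eq_sum_three, abs_one, abs_zero]
    linarith
  · rintro _ ⟨s, hs, rfl⟩
    simp [cuboid, Fin.sum_univ_six, edgeVectors, cubeBasis]
    exact ⟨hs 0, hs 1, hs 2⟩

end Models

/-! ## Voronoi types -/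

/-- The model polytope of the type of a root invariant. -/
def RootInvariant.model : RootInvariant → Set E3
  | .V1 _ => truncatedOctahedron
  | .V2 _ _ _ _ _ => hexaRhombicDodecahedron
  | .V3 _ _ _ _ => rhombicDodecahedron
  | .V4 _ _ _ _ => hexagonalPrism
  | .V5 _ _ _ => cuboid

section Types

variable {Λ : Submodule ℤ E3} {B : Fin 4 → E3}

theorem conorms_eq_zero_iff (h : IsObtuseSuperbase Λ B) (k : Fin 6) : conorms B k = 0 ↔
    (![rootProduct B 0 1, rootProduct B 0 2, rootProduct B 0 3, rootProduct B 1 2,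
      rootProduct B 1 3, rootProduct B 2 3] : Fin 6 → ℝ) k = 0 := by
  have e {i j : Fin 4} (hij : i ≠ j) : conorm B i j = 0 ↔ rootProduct B i j = 0 := by
    rw [← h.rootProduct_sq hij, sq_eq_zero_iff]
  fin_cases k <;> exact e (by decide)

variable [DiscreteTopology Λ] [IsZLattice ℝ Λ]

theorem IsNormal.combEquiv (h : IsObtuseSuperbase Λ B) {ρ : RootInvariant} (hN : IsNormal B ρ)
    (ho : ρ.IsOrdered) : CombEquiv (voronoiDomain Λ) ρ.model := by
  have hz := conorms_eq_zero_iff h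
  cases ρ with
  | V1 M =>
    obtain ⟨h1, h2, h3, h4, h5, h6⟩ := hN
    rw [RootInvariant.model, truncatedOctahedron_eq]
    refine combEquiv_voronoiDomain h linearIndependent_octahedronBasis fun k => ?_
    rw [hz, h1, h2, h3, h4, h5, h6]
    fin_cases k <;> simp [(ho _ _).ne']
  | V2 r01 r13 r12 r02 r03 =>
    obtain ⟨h1, h2, h3, h4, h5, h6⟩ := hN
    obtain ⟨o1, o2, o3, o4, o5, -⟩ := ho
    have p1 := o2.trans_le o3
    have p2 := o2.trans_le o4
    have p3 := p2.trans_le o5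
    rw [RootInvariant.model, hexaRhombicDodecahedron_eq]
    refine combEquiv_voronoiDomain h linearIndependent_dodecahedronBasis fun k => ?_
    rw [hz, h1, h2, h3, h4, h5, h6]
    fin_cases k <;> simp [o1.ne', o2.ne', p1.ne', p2.ne', p3.ne']
  | V3 a b c d =>
    obtain ⟨h1, h2, h3, h4, h5, h6⟩ := hN
    obtain ⟨o1, o2, o3, o4⟩ := ho
    have p1 := o1.trans_le o2
    have p2 := p1.trans_le o3
    have p3 := p2.trans_le o4
    rw [RootInvariant.model, rhombicDodecahedron_eq]
    refine combEquiv_voronoiDomain h linearIndependent_dodecahedronBasis fun k => ?_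
    rw [hz, h1, h2, h3, h4, h5, h6]
    fin_cases k <;> simp [o1.ne', p1.ne', p2.ne', p3.ne']
  | V4 a b c r03 =>
    obtain ⟨h1, h2, h3, h4, h5, h6⟩ := hN
    obtain ⟨o1, o2, o3, o4⟩ := ho
    have p1 := o2.trans_le o3
    have p2 := p1.trans_le o4
    rw [RootInvariant.model, hexagonalPrism_eq]
    refine combEquiv_voronoiDomain h linearIndependent_cubeBasis fun k => ?_
    rw [hz, h1, h2, h3, h4, h5, h6]
    fin_cases k <;> simp [o1.ne', o2.ne', p1.ne', p2.ne']
  | V5 a b c =>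
    obtain ⟨h1, h2, h3, h4, h5, h6⟩ := hN
    obtain ⟨o1, o2, o3⟩ := ho
    have p1 := o1.trans_le o2
    have p2 := p1.trans_le o3
    rw [RootInvariant.model, cuboid_eq]
    refine combEquiv_voronoiDomain h linearIndependent_cubeBasis fun k => ?_
    rw [hz, h1, h2, h3, h4, h5, h6]
    fin_cases k <;> simp [o1.ne', p1.ne', p2.ne']

/-- The condition on the Voronoi domain is automatic, since the zeros of a normal form determine its
combinatorial type. -/
theorem isRootInvariant_iff (h : IsObtuseSuperbase Λ B) {ρ : RootInvariant} :
    IsRootInvariant Λ B ρ ↔ IsRootData B ρ := by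
  have hc (hd : IsRootData B ρ) : CombEquiv (voronoiDomain Λ) ρ.model := by
    obtain ⟨C, hC, hN⟩ := hd.hasNormalForm h
    exact hN.combEquiv hC hd.isOrdered
  cases ρ <;> exact ⟨fun h => h.2, fun hd => ⟨hc hd, hd⟩⟩

theorem IsObtuseSuperbase.isRootInvariant_iff_eq_RI (h : IsObtuseSuperbase Λ B)
    (ρ : RootInvariant) : IsRootInvariant Λ B ρ ↔ ρ = RI Λ := by
  obtain ⟨ρ₀, h₀⟩ := h.exists_isRootData
  obtain ⟨C, hC, hC'⟩ : ∃ C, IsObtuseSuperbase Λ C ∧ IsRootInvariant Λ C (RI Λ) :=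
    Classical.epsilon_spec (p := fun ρ => ∃ B, IsObtuseSuperbase Λ B ∧ IsRootInvariant Λ B ρ)
      ⟨ρ₀, B, h, (isRootInvariant_iff h).2 h₀⟩
  rw [isRootInvariant_iff hC] at hC'
  rw [isRootInvariant_iff h]
  constructor
  · intro hd
    exact hd.unique h hC hC'
  · rintro rfl
    rwa [← h₀.unique h hC hC']

end Types

/-! ## Isometries -/

section Isometry

variable {Λ Λ' : Submodule ℤ E3} {B B' : Fin 4 → E3}

/-- By Selling's formula the conorms determine all norms, so the linear map matching the superbases
is an isometry. -/
theorem exists_isometry_of_conorm_eq (h : IsObtuseSuperbase Λ B) (h' : IsObtuseSuperbase Λ' B')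
    (he : ∀ i j, i ≠ j → conorm B i j = conorm B' i j) :
    ∃ f : E3 → E3, Isometry f ∧ f '' (Λ : Set E3) = (Λ' : Set E3) := by
  let b := basisOfLinearIndependentOfCardEqFinrank h.linearIndependent (by simp)
  have hb (i : Fin 3) : b i = B i.succ := by
    simp only [b, coe_basisOfLinearIndependentOfCardEqFinrank]
    fin_cases i <;> rfl
  let L : E3 →ₗ[ℝ] E3 := b.constr ℝ fun i => B' i.succ
  have hL (i : Fin 3) : L (B i.succ) = B' i.succ := by
    rw [← hb, b.constr_basis]
  have hnorm (x : E3) : ‖L x‖ = ‖x‖ := by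
    obtain ⟨t, rfl⟩ := h.exists_sum_eq x
    have e (C : Fin 4 → E3) : ∑ i : Fin 3, t i • C i.succ =
        ∑ i, (Fin.cons 0 t : Fin 4 → ℝ) i • C i := by
      rw [Fin.sum_univ_succ (n := 3), Fin.cons_zero, zero_smul, zero_add]
      rfl
    rw [map_sum]
    simp only [map_smul, hL]
    rw [← sq_eq_sq₀ (norm_nonneg _) (norm_nonneg _), e, e, norm_sq_sum_smul h.sum_eq_zero,
      norm_sq_sum_smul h'.sum_eq_zero, he 0 1 (by decide), he 0 2 (by decide), he 0 3 (by decide),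
      he 1 2 (by decide), he 1 3 (by decide), he 2 3 (by decide)]
  refine ⟨L, (⟨L, hnorm⟩ : E3 →ₗᵢ[ℝ] E3).isometry, ?_⟩
  have hmap : Λ.map (L.restrictScalars ℤ) = Λ' := by
    rw [← h.span_eq, ← h'.span_eq, Submodule.map_span, ← Set.range_comp]
    congr 2
    ext1 i
    fin_cases i
    · exact hL 0
    · exact hL 1
    · exact hL 2
  rw [← hmap]
  rfl

theorem IsObtuseSuperbase.conorm_eq_of_rootProduct_eq (h : IsObtuseSuperbase Λ B)
    (h' : IsObtuseSuperbase Λ' B') {i j : Fin 4} (hij : i ≠ j)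
    (he : rootProduct B i j = rootProduct B' i j) : conorm B i j = conorm B' i j := by
  rw [← h.rootProduct_sq hij, ← h'.rootProduct_sq hij, he]

theorem exists_isometry_of_hasNormalForm {ρ : RootInvariant} (h : HasNormalForm Λ ρ)
    (h' : HasNormalForm Λ' ρ) :
    ∃ f : E3 → E3, Isometry f ∧ f '' (Λ : Set E3) = (Λ' : Set E3) := by
  obtain ⟨B, hB, hN⟩ := h
  obtain ⟨B', hB', hN'⟩ := h'
  refine exists_isometry_of_conorm_eq hB hB' fun i j hij =>
    hB.conorm_eq_of_rootProduct_eq hB' hij ?_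
  cases ρ <;>
  · obtain ⟨h1, h2, h3, h4, h5, h6⟩ := hN
    obtain ⟨k1, k2, k3, k4, k5, k6⟩ := hN'
    fin_cases i <;> fin_cases j <;> first
      | exact absurd rfl hij
      | exact h1.trans k1.symm
      | exact h2.trans k2.symm
      | exact h3.trans k3.symm
      | exact h4.trans k4.symm
      | exact h5.trans k5.symm
      | exact h6.trans k6.symm
      | exact (rootProduct_comm B _ _).trans ((h1.trans k1.symm).trans (rootProduct_comm B' _ _))
      | exact (rootProduct_comm B _ _).trans ((h2.trans k2.symm).trans (rootProduct_comm B' _ _))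
      | exact (rootProduct_comm B _ _).trans ((h3.trans k3.symm).trans (rootProduct_comm B' _ _))
      | exact (rootProduct_comm B _ _).trans ((h4.trans k4.symm).trans (rootProduct_comm B' _ _))
      | exact (rootProduct_comm B _ _).trans ((h5.trans k5.symm).trans (rootProduct_comm B' _ _))
      | exact (rootProduct_comm B _ _).trans ((h6.trans k6.symm).trans (rootProduct_comm B' _ _))

/-- Isometric lattices are related by a linear isometry. -/
theorem exists_linearIsometry {f : E3 → E3} (hf : Isometry f)
    (hΛ : f '' (Λ : Set E3) = (Λ' : Set E3)) :
    ∃ g : E3 →ₗᵢ[ℝ] E3, Λ.map (g.toLinearMap.restrictScalars ℤ) = Λ' := by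
  let A := hf.affineIsometryOfStrictConvexSpace
  have hA (x : E3) : f x = A.linearIsometry x + f 0 := by
    have := A.map_vadd 0 x
    simpa [A] using this
  have hmem {y : E3} : y ∈ Λ' ↔ ∃ x ∈ Λ, f x = y := by
    rw [← SetLike.mem_coe, ← hΛ]; rfl
  -- The isometry is affine and its translation part is a vector of `Λ'`, so the linear part alone
  -- already maps `Λ` onto `Λ'`.
  have h0 : f 0 ∈ Λ' := hmem.2 ⟨0, zero_mem _, rfl⟩
  refine ⟨A.linearIsometry, ?_⟩
  ext y
  rw [Submodule.mem_map]
  change (∃ x ∈ Λ, A.linearIsometry x = y) ↔ _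
  constructor
  · rintro ⟨x, hx, rfl⟩
    have : f x - f 0 ∈ Λ' := sub_mem (hmem.2 ⟨x, hx, rfl⟩) h0
    rwa [hA, add_sub_cancel_right] at this
  · intro hy
    obtain ⟨x, hx, e⟩ := hmem.1 (add_mem hy h0)
    exact ⟨x, hx, by rw [hA] at e; exact add_right_cancel e⟩

theorem IsObtuseSuperbase.map_linearIsometry [DiscreteTopology Λ] [IsZLattice ℝ Λ]
    [DiscreteTopology Λ'] [IsZLattice ℝ Λ'] (h : IsObtuseSuperbase Λ B) (g : E3 →ₗᵢ[ℝ] E3)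
    (hg : Λ.map (g.toLinearMap.restrictScalars ℤ) = Λ') : IsObtuseSuperbase Λ' (g ∘ B) := by
  rw [isObtuseSuperbase_iff] at h ⊢
  obtain ⟨h1, h2, h3⟩ := h
  refine ⟨?_, ?_, fun i j hij => ?_⟩
  · simp only [Function.comp_apply]
    rw [← map_sum, h1, map_zero]
  · rw [← hg, ← h2, Submodule.map_span, Set.range_comp]
    rfl
  · simpa [conorm] using h3 i j hij

theorem rootProduct_map_linearIsometry (g : E3 →ₗᵢ[ℝ] E3) (B : Fin 4 → E3) :
    rootProduct (g ∘ B) = rootProduct B := by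
  ext i j
  simp [rootProduct]

theorem isRootData_congr (h : rootProduct B = rootProduct B') (ρ : RootInvariant) :
    IsRootData B ρ ↔ IsRootData B' ρ := by
  have hc (σ : Equiv.Perm (Fin 4)) : rootProduct (B ∘ σ) = rootProduct (B' ∘ σ) := by
    ext i j
    rw [rootProduct_comp, rootProduct_comp, h]
  have hr (σ : Equiv.Perm (Fin 4)) : rootForm (B ∘ σ) = rootForm (B' ∘ σ) := by
    simp only [rootForm, hc]
  cases ρ <;> simp only [IsRootData, h, hc, hr]

end Isometry

/-- Every lattice `Λ` in `ℝ³` has an obtuse superbase, every obtuse superbase of `Λ` has exactly one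
root invariant, namely `RI Λ` (so that `RI Λ` does not depend on the superbase), and two lattices
are isometric if and only if their root invariants coincide. -/
theorem mainTheorem1 (Λ Λ' : Submodule ℤ E3)
    [DiscreteTopology Λ] [IsZLattice ℝ Λ] [DiscreteTopology Λ'] [IsZLattice ℝ Λ'] :
    (∃ B, IsObtuseSuperbase Λ B) ∧
    (∀ B, IsObtuseSuperbase Λ B → ∀ ρ, IsRootInvariant Λ B ρ ↔ ρ = RI Λ) ∧
    ((∃ f : E3 → E3, Isometry f ∧ f '' (Λ : Set E3) = (Λ' : Set E3)) ↔ RI Λ = RI Λ') := by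
  refine ⟨exists_isObtuseSuperbase Λ, fun B hB => hB.isRootInvariant_iff_eq_RI, ?_⟩
  obtain ⟨B, hB⟩ := exists_isObtuseSuperbase Λ
  obtain ⟨B', hB'⟩ := exists_isObtuseSuperbase Λ'
  have hd : IsRootData B (RI Λ) :=
    (isRootInvariant_iff hB).1 ((hB.isRootInvariant_iff_eq_RI _).2 rfl)
  have hd' : IsRootData B' (RI Λ') :=
    (isRootInvariant_iff hB').1 ((hB'.isRootInvariant_iff_eq_RI _).2 rfl)
  constructor
  · rintro ⟨f, hf, hΛ⟩
    obtain ⟨g, hg⟩ := exists_linearIsometry hf hΛ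
    -- The image superbase `g ∘ B` belongs to `Λ'` and has the root products of `B`, so uniqueness
    -- within `Λ'` applies.
    exact IsRootData.unique (hB.map_linearIsometry g hg) hB'
      ((isRootData_congr (rootProduct_map_linearIsometry g B) _).2 hd) hd'
  · intro h
    exact exists_isometry_of_hasNormalForm (hd.hasNormalForm hB) (h ▸ hd'.hasNormalForm hB')
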